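/- **Conventions.** Let $V$ be a seven-dimensional vector space over $\mathbb{F}\in\{\mathbb{R},\mathbb{C}\}$. For a basis $e_1,\dots,e_7$ of $V$ with dual basis $e^1,\dots,e^7$ write $e^{ijk}=e^i\wedge e^j\wedge e^k$, etc. For $\mathbb{F}=\mathbb{R}$, a three-form $\varphi\in\Lambda^3V^*$ is a $G_2$-structure if $$\varphi=e^{127}+e^{347}+e^{567}+e^{135}-e^{146}-e^{236}-e^{245}$$ for some basis, and a $G_2^*$-structure if $$\varphi=-e^{127}-e^{347}+e^{567}+e^{135}-e^{146}-e^{236}-e^{245}$$ for some basis; such a basis is called adapted. In both cases $\varphi$ induces a unique (pseudo-)Euclidean metric $g$ and metric volume form $\mathrm{vol}$ on $V$ with $$g(v,w)\,\mathrm{vol}=\tfrac16\,(v\lrcorner\varphi)\wedge(w\lrcorner\varphi)\wedge\varphi\qquad(v,w\in V)\qquad(1)$$ for which every adapted basis is an oriented orthonormal basis. For $\mathbb{F}=\mathbb{C}$, a $(G_2)_{\mathbb{C}}$-structure is a pair $(\varphi,\mathrm{vol})\in\Lambda^3V^*\times\Lambda^7V^*$ for which there is a complex basis with $\mathrm{vol}=e^{1234567}$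 and $\varphi=e^{127}+e^{347}+e^{567}+e^{135}-e^{146}-e^{236}-e^{245}$; it induces a non-degenerate symmetric complex bilinear form $g$ by (1). In all cases the Hodge dual $\star_\varphi\varphi\in\Lambda^4V^*$ is the four-form with $\varphi\wedge\phi=g(\star_\varphi\varphi,\phi)\,\mathrm{vol}$ for all $\phi\in\Lambda^4V^*$, where $g$ also denotes the induced form on $\Lambda^4V^*$. If $V$ is (the vector space underlying) a Lie algebra, the structure is called cocalibrated if $d\star_\varphi\varphi=0$, where $d$ is the Chevalley–Eilenberg differential, $(d\alpha)(X,Y)=-\alpha([X,Y])$ on one-forms. A subspace $U\subseteq V$ is non-degenerate if $g|_{U\times U}$ is non-degenerate. **Statement.** Let $\mathfrak{g}$ be a seven-dimensional real Lie algebra with a six-dimensional Abelian ideal $\mathfrak{u}$. Then: (a) If $\mathfrak{g}$ admits a cocalibrated $G_2$-structure, then it also admits a cocalibrated $G_2^*$-structure. (b) $\mathfrak{g}$ admits a cocalibrated $G_2$-structure if and only if $\mathfrak{g}$ admits a cocalibrated $G_2^*$-structure such that $\mathfrak{u}$ is non-degenerate with respect to the induced pseudo-Euclidean metric. (c) The complexification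 $\mathfrak{g}_{\mathbb{C}}$ admits a cocalibrated $(G_2)_{\mathbb{C}}$-structure if and only if $\mathfrak{g}$ admits a cocalibrated $G_2^*$-structure. Moreover, $\mathfrak{g}_{\mathbb{C}}$ admits a cocalibrated $(G_2)_{\mathbb{C}}$-structure such that $\mathfrak{u}_{\mathbb{C}}$ is non-degenerate with respect to the induced symmetric complex bilinear form if and only if $\mathfrak{g}$ admits a cocalibrated $G_2^*$-structure such that $\mathfrak{u}$ is non-degenerate with respect to the induced pseudo-Euclidean metric, and this is the case if and only if $\mathfrak{g}$ admits a cocalibrated $G_2$-structure. -/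

import Mathlib

open scoped TensorProduct

noncomputable section

namespace CocalibratedG2

/-! ### Multilinear algebra of alternating forms

A `k`-form on a `K`-vector space `V` is an alternating map `V [⋀^Fin k]→ₗ[K] K`. -/

section Forms

variable {K V : Type*} [Field K] [AddCommGroup V] [Module K V]

/-- The decomposable form `α₁ ∧ ⋯ ∧ αₖ`, i.e. `(v₁, …, vₖ) ↦ det (αⱼ (vᵢ))`. -/
def wedgeCovectors {k : ℕ} (α : Fin k → Module.Dual K V) : V [⋀^Fin k]→ₗ[K] K :=
  (Matrix.detRowAlternating (R := K) (n := Fin k)).compLinearMap (LinearMap.pi α)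

theorem wedgeCovectors_apply {k : ℕ} (α : Fin k → Module.Dual K V) (v : Fin k → V) :
    wedgeCovectors α v = (Matrix.of fun i j => α j (v i)).det := rfl

/-- The wedge product of a `k`-form and an `l`-form (the signed sum over all `(k, l)`-shuffles, so
that it is compatible with `wedgeCovectors`). -/
def wedge {k l : ℕ} (α : V [⋀^Fin k]→ₗ[K] K) (β : V [⋀^Fin l]→ₗ[K] K) :
    V [⋀^Fin (k + l)]→ₗ[K] K :=
  ((LinearMap.mul' K K).compAlternatingMap (α.domCoprod β)).domDomCongr finSumFinEquiv

/-- For a basis `e₁, …, eₙ` with dual basis `e¹, …, eⁿ`: the form `e^{I(1)} ∧ ⋯ ∧ e^{I(k)}`.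
Indices start at `0`, so `e^{127}` is `coordForm e ![0, 1, 6]`. -/
def coordForm {n k : ℕ} (e : Module.Basis (Fin n) K V) (I : Fin k → Fin n) :
    V [⋀^Fin k]→ₗ[K] K :=
  wedgeCovectors fun a => e.coord (I a)

/-- `G` is the bilinear form on `k`-forms induced by the non-degenerate symmetric bilinear form `g`
on `V`: on decomposable forms it is given by Gram determinants,
`G (α₁ ∧ ⋯ ∧ αₖ, β₁ ∧ ⋯ ∧ βₖ) = det (g (αᵢ, βⱼ))`, where covectors are written as
`αᵢ = g (vᵢ, ·)`, `βⱼ = g (wⱼ, ·)`, so that `g (αᵢ, βⱼ) = g (vᵢ, wⱼ)`. -/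
def IsInducedOnForms {k : ℕ} (g : LinearMap.BilinForm K V)
    (G : LinearMap.BilinForm K (V [⋀^Fin k]→ₗ[K] K)) : Prop :=
  ∀ v w : Fin k → V,
    G (wedgeCovectors fun i => g (v i)) (wedgeCovectors fun j => g (w j)) =
      (Matrix.of fun i j => g (v i) (w j)).det

/-- `χ` is the Hodge dual `⋆ψ` of the `k`-form `ψ` with respect to the non-degenerate symmetric
bilinear form `g` and the volume form `vol`: `ψ ∧ φ = g (⋆ψ, φ) vol` for all `l`-forms `φ`. -/
def IsHodgeDual {k l : ℕ} (g : LinearMap.BilinForm K V) (vol : V [⋀^Fin (k + l)]→ₗ[K] K)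
    (ψ : V [⋀^Fin k]→ₗ[K] K) (χ : V [⋀^Fin l]→ₗ[K] K) : Prop :=
  ∃ G : LinearMap.BilinForm K (V [⋀^Fin l]→ₗ[K] K),
    IsInducedOnForms g G ∧ ∀ φ : V [⋀^Fin l]→ₗ[K] K, wedge ψ φ = G χ φ • vol

/-- The relation `g(v, w) vol = (1/6) (v ⌟ φ) ∧ (w ⌟ φ) ∧ φ` for all `v, w`. -/
def MetricRelation (φ : V [⋀^Fin 3]→ₗ[K] K) (g : LinearMap.BilinForm K V)
    (vol : V [⋀^Fin 7]→ₗ[K] K) : Prop :=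
  ∀ v w : V, g v w • vol = (6 : K)⁻¹ • wedge (wedge (φ.curryLeft v) (φ.curryLeft w)) φ

/-- `e^{127} + e^{347} + e^{567} + e^{135} - e^{146} - e^{236} - e^{245}`. -/
def g2Form (e : Module.Basis (Fin 7) K V) : V [⋀^Fin 3]→ₗ[K] K :=
  coordForm e ![0, 1, 6] + coordForm e ![2, 3, 6] + coordForm e ![4, 5, 6]
    + coordForm e ![0, 2, 4] - coordForm e ![0, 3, 5] - coordForm e ![1, 2, 5]
    - coordForm e ![1, 3, 4]

/-- `-e^{127} - e^{347} + e^{567} + e^{135} - e^{146} - e^{236} - e^{245}`. -/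
def g2StarForm (e : Module.Basis (Fin 7) K V) : V [⋀^Fin 3]→ₗ[K] K :=
  -coordForm e ![0, 1, 6] - coordForm e ![2, 3, 6] + coordForm e ![4, 5, 6]
    + coordForm e ![0, 2, 4] - coordForm e ![0, 3, 5] - coordForm e ![1, 2, 5]
    - coordForm e ![1, 3, 4]

end Forms

/-! ### `G₂`-, `G₂*`- and `(G₂)_ℂ`-structures on vector spaces -/

section Real

variable {V : Type*} [AddCommGroup V] [Module ℝ V]

/-- A `G₂`-structure on a real vector space (of dimension seven). -/
def IsG2Structure (φ : V [⋀^Fin 3]→ₗ[ℝ] ℝ) : Prop :=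
  ∃ e : Module.Basis (Fin 7) ℝ V, φ = g2Form e

/-- A `G₂*`-structure on a real vector space (of dimension seven). -/
def IsG2StarStructure (φ : V [⋀^Fin 3]→ₗ[ℝ] ℝ) : Prop :=
  ∃ e : Module.Basis (Fin 7) ℝ V, φ = g2StarForm e

/-- `g` and `vol` are the (pseudo-)Euclidean metric and the metric volume form induced by the
`G₂`- or `G₂*`-structure `φ`: they satisfy `g(v, w) vol = (1/6) (v ⌟ φ) ∧ (w ⌟ φ) ∧ φ`, and every
adapted basis of `φ` is an oriented orthonormal basis. -/
structure IsInducedMetric (φ : V [⋀^Fin 3]→ₗ[ℝ] ℝ) (g : LinearMap.BilinForm ℝ V)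
    (vol : V [⋀^Fin 7]→ₗ[ℝ] ℝ) : Prop where
  relation : MetricRelation φ g vol
  orthonormal : ∀ e : Module.Basis (Fin 7) ℝ V, φ = g2Form e ∨ φ = g2StarForm e →
    vol e = 1 ∧ ∀ i j : Fin 7, |g (e i) (e j)| = if i = j then 1 else 0

end Real

section Complex

variable {W : Type*} [AddCommGroup W] [Module ℂ W]

/-- A `(G₂)_ℂ`-structure on a complex vector space (of dimension seven). -/
def IsG2ComplexStructure (φ : W [⋀^Fin 3]→ₗ[ℂ] ℂ) (vol : W [⋀^Fin 7]→ₗ[ℂ] ℂ) : Prop :=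
  ∃ e : Module.Basis (Fin 7) ℂ W, vol = coordForm e id ∧ φ = g2Form e

end Complex

/-! ### Cocalibrated structures on Lie algebras -/

section LieAlgebra

variable {K 𝔤 : Type*} [Field K] [LieRing 𝔤] [LieAlgebra K 𝔤]

/-- The exterior derivative of a form of positive degree on a Lie algebra (the Chevalley–Eilenberg
differential with trivial coefficients), as a function of its arguments:
`dα (v₀, …, vₘ) = ∑_{i < j} (-1)^{i + j} α (⁅vᵢ, vⱼ⁆, v₀, …, v̂ᵢ, …, v̂ⱼ, …, vₘ)`.
In particular `dα (X, Y) = -α ⁅X, Y⁆` for a one-form `α`. -/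
def lieExtDeriv {k : ℕ} (α : 𝔤 [⋀^Fin (k + 1)]→ₗ[K] K) (v : Fin (k + 2) → 𝔤) : K :=
  ∑ j : Fin (k + 2), ∑ i : Fin (k + 1),
    if i.castSucc < j then
      (-1) ^ ((i : ℕ) + (j : ℕ)) *
        α (Fin.cons ⁅v i.castSucc, v j⁆ (i.removeNth (j.removeNth v)))
    else 0

/-- The Hodge dual of the three-form `φ` with respect to `g` and `vol` is closed. -/
def HasClosedHodgeDual (g : LinearMap.BilinForm K 𝔤) (vol : 𝔤 [⋀^Fin 7]→ₗ[K] K)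
    (φ : 𝔤 [⋀^Fin 3]→ₗ[K] K) : Prop :=
  ∃ Ψ : 𝔤 [⋀^Fin 4]→ₗ[K] K, IsHodgeDual g vol φ Ψ ∧ lieExtDeriv Ψ = 0

end LieAlgebra

/-- `φ` is a cocalibrated `G₂`-structure on the real Lie algebra `𝔤`, with induced metric `g` and
volume form `vol`. -/
def IsCocalibratedG2 {𝔤 : Type*} [LieRing 𝔤] [LieAlgebra ℝ 𝔤] (φ : 𝔤 [⋀^Fin 3]→ₗ[ℝ] ℝ)
    (g : LinearMap.BilinForm ℝ 𝔤) (vol : 𝔤 [⋀^Fin 7]→ₗ[ℝ] ℝ) : Prop :=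
  IsG2Structure φ ∧ IsInducedMetric φ g vol ∧ HasClosedHodgeDual g vol φ

/-- `φ` is a cocalibrated `G₂*`-structure on the real Lie algebra `𝔤`, with induced metric `g` and
volume form `vol`. -/
def IsCocalibratedG2Star {𝔤 : Type*} [LieRing 𝔤] [LieAlgebra ℝ 𝔤] (φ : 𝔤 [⋀^Fin 3]→ₗ[ℝ] ℝ)
    (g : LinearMap.BilinForm ℝ 𝔤) (vol : 𝔤 [⋀^Fin 7]→ₗ[ℝ] ℝ) : Prop :=
  IsG2StarStructure φ ∧ IsInducedMetric φ g vol ∧ HasClosedHodgeDual g vol φ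

/-- `(φ, vol)` is a cocalibrated `(G₂)_ℂ`-structure on the complex Lie algebra `𝔤`, with induced
complex symmetric bilinear form `g` (which is determined by the relation, as `vol ≠ 0`). -/
def IsCocalibratedG2Complex {𝔤 : Type*} [LieRing 𝔤] [LieAlgebra ℂ 𝔤] (φ : 𝔤 [⋀^Fin 3]→ₗ[ℂ] ℂ)
    (g : LinearMap.BilinForm ℂ 𝔤) (vol : 𝔤 [⋀^Fin 7]→ₗ[ℂ] ℂ) : Prop :=
  IsG2ComplexStructure φ vol ∧ MetricRelation φ g vol ∧ HasClosedHodgeDual g vol φ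

/-- `𝔤` admits a cocalibrated `G₂`-structure. -/
def AdmitsCocalibratedG2 (𝔤 : Type*) [LieRing 𝔤] [LieAlgebra ℝ 𝔤] : Prop :=
  ∃ φ g vol, IsCocalibratedG2 (𝔤 := 𝔤) φ g vol

/-- `𝔤` admits a cocalibrated `G₂*`-structure. -/
def AdmitsCocalibratedG2Star (𝔤 : Type*) [LieRing 𝔤] [LieAlgebra ℝ 𝔤] : Prop :=
  ∃ φ g vol, IsCocalibratedG2Star (𝔤 := 𝔤) φ g vol

/-- `𝔤` admits a cocalibrated `G₂*`-structure for whose induced metric `𝔲` is non-degenerate. -/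
def AdmitsCocalibratedG2StarNondeg (𝔤 : Type*) [LieRing 𝔤] [LieAlgebra ℝ 𝔤]
    (𝔲 : Submodule ℝ 𝔤) : Prop :=
  ∃ φ g vol, IsCocalibratedG2Star (𝔤 := 𝔤) φ g vol ∧ (g.restrict 𝔲).Nondegenerate

/-- `𝔤` admits a cocalibrated `(G₂)_ℂ`-structure. -/
def AdmitsCocalibratedG2Complex (𝔤 : Type*) [LieRing 𝔤] [LieAlgebra ℂ 𝔤] : Prop :=
  ∃ φ g vol, IsCocalibratedG2Complex (𝔤 := 𝔤) φ g vol

/-- `𝔤` admits a cocalibrated `(G₂)_ℂ`-structure for whose induced symmetric complex bilinear form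
`𝔲` is non-degenerate. -/
def AdmitsCocalibratedG2ComplexNondeg (𝔤 : Type*) [LieRing 𝔤] [LieAlgebra ℂ 𝔤]
    (𝔲 : Submodule ℂ 𝔤) : Prop :=
  ∃ φ g vol, IsCocalibratedG2Complex (𝔤 := 𝔤) φ g vol ∧ (g.restrict 𝔲).Nondegenerate

end CocalibratedG2

end

/-!
The Lie bracket of `𝔤` is `⁅v, w⁆ = ξ(v) A w - ξ(w) A v` for a covector `ξ` with kernel `𝔲` and an
endomorphism `A` with image in `𝔲`, so that `d⋆φ = -ξ ∧ (A · ⋆φ)`, where `A` acts on forms as a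
derivation. Contraction with the volume form turns `ξ ∧ ⋆φ` into the bivector `ξ^♯ ⌟ φ`, which
lies in `Λ² 𝔲`, and closedness of `⋆φ` into the statement that this bivector is an eigenvector of
`A` for the eigenvalue `tr A`.

It remains to see which bivectors in `Λ² 𝔲` are of the form `ξ^♯ ⌟ φ`, and this depends only on the
rank. If `ξ` is not a null covector, i.e. if `𝔲` is non-degenerate, one obtains precisely the
bivectors of rank `6`; this is the only possibility for a `G₂`-structure. A `G₂*`-structure also
admits null covectors, which give the rank `4`. Over `ℂ` the `G₂`- and the `G₂*`-form are
equivalent, by multiplying four of the basis covectors by `i`.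

Real and complex ranks are compared as follows. If `B` is a complex eigenbivector with a
non-vanishing minor of size `r`, this minor of `re B + t im B` is a polynomial in `t` which does not
vanish at `t = i`, hence does not vanish at some real `t`.
-/

noncomputable section

namespace CocalibratedG2

section Forms

variable {K V : Type*} [Field K] [AddCommGroup V] [Module K V]

/-- Evaluation of `k`-forms at a tuple of vectors, as a linear functional. -/
def evalForm (K : Type*) {V : Type*} [Field K] [AddCommGroup V] [Module K V] {k : ℕ}
    (v : Fin k → V) : Module.Dual K (V [⋀^Fin k]→ₗ[K] K) where
  toFun α := α v
  map_add' _ _ := rfl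
  map_smul' _ _ := rfl

theorem evalForm_apply {k : ℕ} (v : Fin k → V) (α : V [⋀^Fin k]→ₗ[K] K) :
    evalForm K v α = α v := rfl

theorem wedgeCovectors_eq_sum {k : ℕ} (α : Fin k → Module.Dual K V) (v : Fin k → V) :
    wedgeCovectors α v = ∑ σ : Equiv.Perm (Fin k), Equiv.Perm.sign σ • ∏ i, α i (v (σ i)) := by
  simp [wedgeCovectors_apply, Matrix.det_apply]

theorem wedgeCovectors_eq_alternatization {k : ℕ} (α : Fin k → Module.Dual K V) :
    wedgeCovectors α = MultilinearMap.alternatization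
      ((MultilinearMap.mkPiAlgebra K (Fin k) K).compLinearMap α) := by
  ext v
  simp [wedgeCovectors_eq_sum, MultilinearMap.alternatization_apply]

theorem wedge_wedgeCovectors {k l : ℕ} (α : Fin k → Module.Dual K V)
    (β : Fin l → Module.Dual K V) :
    wedge (wedgeCovectors α) (wedgeCovectors β) = wedgeCovectors (Fin.append α β) := by
  ext v
  rw [wedgeCovectors_eq_sum, wedge, wedgeCovectors_eq_alternatization,
    wedgeCovectors_eq_alternatization, ← MultilinearMap.domCoprod_alternization]
  simp only [AlternatingMap.domDomCongr_apply, LinearMap.compAlternatingMap_apply,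
    MultilinearMap.alternatization_apply, map_sum]
  refine Fintype.sum_equiv finSumFinEquiv.permCongr _ _ fun σ => ?_
  rw [Equiv.Perm.sign_permCongr, Units.smul_def, Units.smul_def, map_zsmul]
  congr 1
  simp [MultilinearMap.domDomCongr_apply, MultilinearMap.domCoprod_apply,
    ← finSumFinEquiv.prod_comp, Fintype.prod_sum_type, Equiv.permCongr_apply]

theorem wedge_coordForm {n k l : ℕ} (e : Module.Basis (Fin n) K V) (I : Fin k → Fin n)
    (J : Fin l → Fin n) :
    wedge (coordForm e I) (coordForm e J) = coordForm e (Fin.append I J) := by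
  rw [coordForm, coordForm, wedge_wedgeCovectors, coordForm]
  congr 1
  ext1 a
  refine Fin.addCases (fun i => ?_) (fun i => ?_) a <;> simp

/-- The wedge product as a bilinear map. -/
def wedgeBilin (K V : Type*) [Field K] [AddCommGroup V] [Module K V] (k l : ℕ) :
    (V [⋀^Fin k]→ₗ[K] K) →ₗ[K] (V [⋀^Fin l]→ₗ[K] K) →ₗ[K] (V [⋀^Fin (k + l)]→ₗ[K] K) :=
  (TensorProduct.mk K _ _).compr₂ ((AlternatingMap.domDomCongrₗ K finSumFinEquiv).toLinearMap ∘ₗ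
    (LinearMap.mul' K K).compAlternatingMapₗ K ∘ₗ AlternatingMap.domCoprod')

theorem wedgeBilin_apply {k l : ℕ} (α : V [⋀^Fin k]→ₗ[K] K) (β : V [⋀^Fin l]→ₗ[K] K) :
    wedgeBilin K V k l α β = wedge α β := rfl

/-- The product `α ∧ η` of a covector with a form, defined by expansion along the covector. It
avoids the index type `Fin (1 + k)` of `wedge`. -/
def covectorWedge {k : ℕ} :
    Module.Dual K V →ₗ[K] (V [⋀^Fin k]→ₗ[K] K) →ₗ[K] V [⋀^Fin (k + 1)]→ₗ[K] K :=
  LinearMap.smulRightₗ.compr₂ AlternatingMap.alternatizeUncurryFinLM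

theorem covectorWedge_apply {k : ℕ} (α : Module.Dual K V) (η : V [⋀^Fin k]→ₗ[K] K)
    (v : Fin (k + 1) → V) :
    covectorWedge α η v = ∑ i : Fin (k + 1), (-1) ^ (i : ℕ) * (α (v i) * η (i.removeNth v)) := by
  simp [covectorWedge, AlternatingMap.alternatizeUncurryFin_apply]

theorem covectorWedge_wedgeCovectors {k : ℕ} (α : Module.Dual K V)
    (β : Fin k → Module.Dual K V) :
    covectorWedge α (wedgeCovectors β) = wedgeCovectors (Fin.cons α β : Fin (k + 1) → _) := by
  ext v
  rw [covectorWedge_apply, wedgeCovectors_apply, Matrix.det_succ_column_zero]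
  refine Finset.sum_congr rfl fun i _ => ?_
  rw [mul_assoc]
  rfl

theorem curryLeft_wedgeCovectors {k : ℕ} (α : Fin (k + 1) → Module.Dual K V) (v : V) :
    (wedgeCovectors α).curryLeft v =
      ∑ m : Fin (k + 1), ((-1) ^ (m : ℕ) * α m v) • wedgeCovectors (α ∘ m.succAbove) := by
  ext w
  rw [AlternatingMap.curryLeft_apply_apply, wedgeCovectors_apply, Matrix.det_succ_row_zero,
    ← evalForm_apply, map_sum]
  rfl

theorem coordForm_succ {n k : ℕ} (e : Module.Basis (Fin n) K V) (I : Fin (k + 1) → Fin n) :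
    coordForm e I = covectorWedge (e.coord (I 0)) (coordForm e fun i => I i.succ) := by
  rw [coordForm, coordForm, covectorWedge_wedgeCovectors]
  congr 1
  exact (Fin.cons_self_tail _).symm

/-- The value of `e^I` on the basis vectors with indices `J`, for a list `J` without repetitions:
the sign of the permutation taking `J` to `I`, or `0` if there is none. -/
def indexSign {n : ℕ} : List (Fin n) → List (Fin n) → ℤ
  | [], _ => 1
  | a :: I, J => if a ∈ J then (-1) ^ J.idxOf a * indexSign I (J.erase a) else 0

theorem ofFn_removeNth {α : Type*} {k : ℕ} (J : Fin (k + 1) → α) (m : Fin (k + 1)) :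
    List.ofFn (m.removeNth J) = (List.ofFn J).eraseIdx m := by
  refine List.ext_getElem (by simp [List.length_eraseIdx, m.isLt]) fun i h₁ h₂ => ?_
  simp only [List.getElem_ofFn, List.getElem_eraseIdx, Fin.removeNth, Fin.succAbove]
  split_ifs <;> simp_all [Fin.lt_def]

theorem coordForm_apply_comp {n k : ℕ} (e : Module.Basis (Fin n) K V) (I : Fin k → Fin n)
    {J : Fin k → Fin n} (hJ : Function.Injective J) :
    coordForm e I (e ∘ J) = (indexSign (List.ofFn I) (List.ofFn J) : K) := by
  induction k with
  | zero => simp [coordForm, wedgeCovectors_apply, indexSign]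
  | succ k ih =>
    rw [coordForm_succ, covectorWedge_apply, List.ofFn_succ, indexSign]
    by_cases hmem : ∃ m, J m = I 0
    · obtain ⟨m, hm⟩ := hmem
      have hidx : (List.ofFn J).idxOf (I 0) = m := by
        have := (List.nodup_ofFn.2 hJ).idxOf_getElem m (by simp [m.is_le])
        rwa [List.getElem_ofFn, hm] at this
      rw [Finset.sum_eq_single m _ (by simp), if_pos (List.mem_ofFn.2 ⟨m, hm⟩), hidx,
        List.erase_eq_eraseIdx_of_idxOf hidx, ← ofFn_removeNth]
      · have := ih (fun i => I i.succ) (J := m.removeNth J)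
          (hJ.comp Fin.succAbove_right_injective)
        simp only [Function.comp_apply, hm, Module.Basis.coord_apply, Module.Basis.repr_self,
          Finsupp.single_eq_same, one_mul, Int.cast_mul, Int.cast_pow, Int.cast_neg, Int.cast_one]
        rw [← this]
        rfl
      · intro i _ hi
        have : J i ≠ I 0 := fun h => hi (hJ (h.trans hm.symm))
        simp [this]
    · rw [if_neg (by rwa [List.mem_ofFn]), Int.cast_zero]
      push Not at hmem
      exact Finset.sum_eq_zero fun i _ => by simp [hmem i]

/-- Integral combinations of coordinate forms, as lists of coefficients and multi-indices. They
are computable, so that identities between concrete forms become decidable. -/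
abbrev FormTerms (n k : ℕ) : Type := List (ℤ × (Fin k → Fin n))

namespace FormTerms

variable {n k l : ℕ}

/-- The form encoded by a list of terms. -/
def toForm (e : Module.Basis (Fin n) K V) (L : FormTerms n k) : V [⋀^Fin k]→ₗ[K] K :=
  (L.map fun p => (p.1 : K) • coordForm e p.2).sum

/-- The terms of the wedge product. -/
def mul (L : FormTerms n k) (M : FormTerms n l) : FormTerms n (k + l) :=
  L.flatMap fun p => M.map fun q => (p.1 * q.1, Fin.append p.2 q.2)

/-- The terms of the contraction with the `i`-th basis vector. -/
def contract (i : Fin n) (L : FormTerms n (k + 1)) : FormTerms n k :=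
  L.flatMap fun p => ((List.finRange (k + 1)).filter fun m => p.2 m = i).map fun m : Fin (k + 1) =>
    ((-1) ^ (m : ℕ) * p.1, p.2 ∘ m.succAbove)

/-- The value of the encoded form on the basis vectors with indices `J`, if `J` is injective. -/
def coeff (L : FormTerms n k) (J : Fin k → Fin n) : ℤ :=
  (L.map fun p => p.1 * indexSign (List.ofFn p.2) (List.ofFn J)).sum

theorem toForm_nil (e : Module.Basis (Fin n) K V) : toForm e ([] : FormTerms n k) = 0 := rfl

theorem toForm_cons (e : Module.Basis (Fin n) K V) (p : ℤ × (Fin k → Fin n))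
    (L : FormTerms n k) : toForm e (p :: L) = (p.1 : K) • coordForm e p.2 + toForm e L := by
  simp [toForm]

theorem toForm_append (e : Module.Basis (Fin n) K V) (L M : FormTerms n k) :
    toForm e (L ++ M) = toForm e L + toForm e M := by
  simp [toForm]

theorem toForm_apply_comp (e : Module.Basis (Fin n) K V) (L : FormTerms n k) {J : Fin k → Fin n}
    (hJ : Function.Injective J) : toForm e L (e ∘ J) = (coeff L J : K) := by
  induction L with
  | nil => simp [toForm_nil, coeff]
  | cons p L ih => simp [toForm_cons, coordForm_apply_comp e p.2 hJ, ih, coeff]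

theorem wedge_coordForm_toForm (e : Module.Basis (Fin n) K V) (p : ℤ × (Fin k → Fin n))
    (M : FormTerms n l) :
    wedge ((p.1 : K) • coordForm e p.2) (toForm e M) =
      toForm e (M.map fun q => (p.1 * q.1, Fin.append p.2 q.2)) := by
  induction M with
  | nil => exact map_zero (wedgeBilin K V k l _)
  | cons q M ih =>
    rw [toForm_cons, List.map_cons, toForm_cons, ← ih, ← wedge_coordForm]
    simp only [← wedgeBilin_apply, map_add, map_smul, LinearMap.smul_apply, smul_smul,
      Int.cast_mul]
    rw [mul_comm (q.1 : K)]

theorem wedge_toForm (e : Module.Basis (Fin n) K V) (L : FormTerms n k) (M : FormTerms n l) :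
    wedge (toForm e L) (toForm e M) = toForm e (mul L M) := by
  induction L with
  | nil => exact LinearMap.map_zero₂ (wedgeBilin K V k l) _
  | cons p L ih =>
    rw [mul, List.flatMap_cons, toForm_append, ← wedge_coordForm_toForm, toForm_cons,
      ← wedgeBilin_apply, map_add, LinearMap.add_apply, wedgeBilin_apply, wedgeBilin_apply, ih,
      mul]

theorem curryLeft_coordForm (e : Module.Basis (Fin n) K V) (I : Fin (k + 1) → Fin n)
    (i : Fin n) : (coordForm e I).curryLeft (e i) =
      ∑ m : Fin (k + 1) with I m = i, (-1 : K) ^ (m : ℕ) • coordForm e (I ∘ m.succAbove) := by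
  rw [coordForm, curryLeft_wedgeCovectors, Finset.sum_filter]
  refine Finset.sum_congr rfl fun m _ => ?_
  by_cases hm : I m = i <;> simp [hm, coordForm, Function.comp_def]

theorem curryLeft_toForm (e : Module.Basis (Fin n) K V) (L : FormTerms n (k + 1)) (i : Fin n) :
    (toForm e L).curryLeft (e i) = toForm e (contract i L) := by
  induction L with
  | nil => rfl
  | cons p L ih =>
    rw [contract, List.flatMap_cons, toForm_append, ← contract, ← ih, toForm_cons,
      AlternatingMap.curryLeft_add, AlternatingMap.curryLeft_smul, LinearMap.add_apply,
      LinearMap.smul_apply, curryLeft_coordForm, Finset.smul_sum]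
    congr 1
    rw [toForm, List.map_map, ← List.sum_toFinset (M := V [⋀^Fin k]→ₗ[K] K) _
      ((List.nodup_finRange _).filter _), List.toFinset_filter, List.toFinset_finRange]
    simp only [Function.comp_apply, decide_eq_true_eq, Int.cast_mul, Int.cast_pow, Int.cast_neg,
      Int.cast_one, smul_smul, mul_comm]

end FormTerms

theorem coordForm_id_eq_det {n : ℕ} (e : Module.Basis (Fin n) K V) : coordForm e id = e.det := by
  ext v
  rw [coordForm, wedgeCovectors_apply, Module.Basis.det_apply, ← Matrix.det_transpose]
  rfl

theorem coordForm_id_self {n : ℕ} (e : Module.Basis (Fin n) K V) : coordForm e id e = 1 := by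
  rw [coordForm_id_eq_det, e.det_self]

theorem topForm_ext {n : ℕ} (e : Module.Basis (Fin n) K V) {α β : V [⋀^Fin n]→ₗ[K] K}
    (h : α e = β e) : α = β := by
  rw [α.eq_smul_basis_det e, β.eq_smul_basis_det e, h]

theorem topForm_ext_iff {n : ℕ} (e : Module.Basis (Fin n) K V) {α β : V [⋀^Fin n]→ₗ[K] K} :
    α = β ↔ α e = β e :=
  ⟨fun h => congrArg (evalForm K e) h, topForm_ext e⟩

theorem eq_coordForm_id_iff {n : ℕ} {e : Module.Basis (Fin n) K V} {vol : V [⋀^Fin n]→ₗ[K] K} :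
    vol = coordForm e id ↔ vol e = 1 := by
  rw [topForm_ext_iff e, coordForm_id_self]

theorem alternatingMap_ext_orderEmb {n k : ℕ} (e : Module.Basis (Fin n) K V)
    {α β : V [⋀^Fin k]→ₗ[K] K}
    (h : ∀ J : Fin k ↪o Fin n, α (e ∘ J) = β (e ∘ J)) : α = β := by
  refine Module.Basis.ext_alternating e fun J hJ => ?_
  have hsort : StrictMono (J ∘ Tuple.sort J) :=
    (Tuple.monotone_sort J).strictMono_of_injective (hJ.comp (Tuple.sort J).injective)
  have hα := h (OrderEmbedding.ofStrictMono _ hsort)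
  rw [OrderEmbedding.coe_ofStrictMono, ← Function.comp_assoc, α.map_perm, β.map_perm] at hα
  exact smul_left_cancel _ hα

theorem coordForm_apply_orderEmb {n k : ℕ} (e : Module.Basis (Fin n) K V)
    (I J : Fin k ↪o Fin n) : coordForm e I (e ∘ J) = if I = J then 1 else 0 := by
  rw [coordForm, wedgeCovectors_apply]
  split_ifs with h
  · rw [h, ← Matrix.det_one (n := Fin k) (R := K)]
    congr 1
    ext a b
    simp [Finsupp.single_apply, Matrix.one_apply]
  · obtain ⟨a, ha⟩ : ∃ a, I a ∉ Set.range J := by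
      by_contra! hsub
      refine h (DFunLike.coe_injective ((I.strictMono.range_inj J.strictMono).1 ?_))
      refine Set.eq_of_subset_of_ncard_le (Set.range_subset_iff.2 hsub) ?_
      simp [Set.ncard_range_of_injective, I.injective, J.injective]
    refine Matrix.det_eq_zero_of_column_eq_zero a fun b => ?_
    have : J b ≠ I a := fun hb => ha ⟨b, hb⟩
    simp [this]

theorem eq_sum_smul_coordForm {n k : ℕ} (e : Module.Basis (Fin n) K V)
    (η : V [⋀^Fin k]→ₗ[K] K) : η = ∑ I : Fin k ↪o Fin n, η (e ∘ I) • coordForm e I := by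
  refine alternatingMap_ext_orderEmb e fun J => ?_
  rw [← evalForm_apply (e ∘ J) (∑ _, _), map_sum]
  simp [evalForm_apply, coordForm_apply_orderEmb]

theorem linearMap_ext_coordForm {n k : ℕ} {M : Type*} [AddCommGroup M] [Module K M]
    (e : Module.Basis (Fin n) K V) {f g : (V [⋀^Fin k]→ₗ[K] K) →ₗ[K] M}
    (h : ∀ J : Fin k ↪o Fin n, f (coordForm e J) = g (coordForm e J)) : f = g := by
  ext η
  rw [eq_sum_smul_coordForm e η]
  simp only [map_sum, map_smul, h]

theorem wedgeCovectors_eval {k : ℕ} (α : Fin k → Module.Dual K V) (v : Fin k → V) :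
    wedgeCovectors (fun i => Module.Dual.eval K V (v i)) α = wedgeCovectors α v := by
  rw [wedgeCovectors_apply, wedgeCovectors_apply, ← Matrix.det_transpose]
  rfl

theorem apply_wedgeCovectors_eq_of_coordForm {n k : ℕ} (e : Module.Basis (Fin n) K V)
    {f : Module.Dual K (V [⋀^Fin k]→ₗ[K] K)} {T : (Module.Dual K V) [⋀^Fin k]→ₗ[K] K}
    (h : ∀ J : Fin k ↪o Fin n, f (coordForm e J) = T (e.coord ∘ J)) (α : Fin k → Module.Dual K V) :
    f (wedgeCovectors α) = T α := by
  rw [eq_sum_smul_coordForm e (wedgeCovectors α), eq_sum_smul_coordForm e.dualBasis T, map_sum,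
    ← evalForm_apply, map_sum]
  refine Finset.sum_congr rfl fun J _ => ?_
  have hα : coordForm e.dualBasis J α = wedgeCovectors α (e ∘ J) := by
    have hcoord (i : Fin n) : e.dualBasis.coord i = Module.Dual.eval K V (e i) :=
      e.dualBasis.ext fun j => by simp [Finsupp.single_apply]
    simp only [coordForm, hcoord]
    exact wedgeCovectors_eval α (e ∘ J)
  rw [map_smul, map_smul, evalForm_apply, hα, h, e.coe_dualBasis, smul_eq_mul, smul_eq_mul,
    mul_comm]

theorem intUnit_cast_mul_self (u : ℤˣ) : ((u : ℤ) : K) * ((u : ℤ) : K) = 1 := by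
  rcases Int.units_eq_one_or u with rfl | rfl <;> simp

/-- The symmetric bilinear form with `g(eᵢ, eⱼ) = εᵢ δᵢⱼ`. -/
def signedMetric {n : ℕ} (ε : Fin n → ℤˣ) (e : Module.Basis (Fin n) K V) :
    LinearMap.BilinForm K V :=
  ∑ i, ((ε i : ℤ) : K) • (LinearMap.mul K K).compl₁₂ (e.coord i) (e.coord i)

/-- The isomorphism `V* → V` inverse to `v ↦ g(v, ·)`, for `g = signedMetric ε e`. -/
def sharp {n : ℕ} (ε : Fin n → ℤˣ) (e : Module.Basis (Fin n) K V) : Module.Dual K V →ₗ[K] V :=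
  ∑ j, (Module.Dual.eval K V (e j)).smulRight (((ε j : ℤ) : K) • e j)

section SignedMetric

variable {n k l : ℕ} (ε : Fin n → ℤˣ) (e : Module.Basis (Fin n) K V)

theorem signedMetric_apply (v w : V) :
    signedMetric ε e v w = ∑ i, ((ε i : ℤ) : K) * (e.coord i v * e.coord i w) := by
  simp [signedMetric]

theorem signedMetric_comm (v w : V) : signedMetric ε e v w = signedMetric ε e w v := by
  simp only [signedMetric_apply, mul_comm (e.coord _ v)]

theorem signedMetric_apply_basis (v : V) (i : Fin n) :
    signedMetric ε e v (e i) = ((ε i : ℤ) : K) * e.coord i v := by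
  simp [signedMetric_apply, Finsupp.single_apply]

theorem coord_sharp (α : Module.Dual K V) (i : Fin n) :
    e.coord i (sharp ε e α) = ((ε i : ℤ) : K) * α (e i) := by
  simp [sharp, Finsupp.single_apply, mul_comm]

theorem sharp_coord (i : Fin n) : sharp ε e (e.coord i) = ((ε i : ℤ) : K) • e i :=
  e.ext_elem fun j => by
    rw [← e.coord_apply, coord_sharp]
    by_cases h : i = j <;> simp [h]

theorem signedMetric_sharp (α : Module.Dual K V) : signedMetric ε e (sharp ε e α) = α :=
  e.ext fun i => by
    rw [signedMetric_apply_basis, coord_sharp, ← mul_assoc, intUnit_cast_mul_self, one_mul]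

theorem sharp_signedMetric (v : V) : sharp ε e (signedMetric ε e v) = v :=
  e.ext_elem fun i => by
    rw [← e.coord_apply, coord_sharp, signedMetric_apply_basis, ← mul_assoc,
      intUnit_cast_mul_self, one_mul, e.coord_apply]

/-- The bilinear form on `k`-forms for which the coordinate forms `e^I` with `I` increasing are
orthogonal, with `g(e^I, e^I) = ∏ₐ ε (I a)`. -/
def inducedForm (k : ℕ) : LinearMap.BilinForm K (V [⋀^Fin k]→ₗ[K] K) :=
  ∑ J : Fin k ↪o Fin n, (∏ a, ((ε (J a) : ℤ) : K)) •
    (LinearMap.mul K K).compl₁₂ (evalForm K (e ∘ J)) (evalForm K (e ∘ J))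

theorem inducedForm_coordForm (η : V [⋀^Fin k]→ₗ[K] K) (J : Fin k ↪o Fin n) :
    inducedForm ε e k η (coordForm e J) = (∏ a, ((ε (J a) : ℤ) : K)) * η (e ∘ J) := by
  simp [inducedForm, evalForm_apply, coordForm_apply_orderEmb]

theorem inducedForm_wedgeCovectors (η : V [⋀^Fin k]→ₗ[K] K) (α : Fin k → Module.Dual K V) :
    inducedForm ε e k η (wedgeCovectors α) = η (sharp ε e ∘ α) := by
  refine apply_wedgeCovectors_eq_of_coordForm (T := η.compLinearMap (sharp ε e)) e (fun J => ?_) α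
  have hsharp : sharp ε e ∘ e.coord ∘ J = fun a => ((ε (J a) : ℤ) : K) • e (J a) :=
    funext fun a => sharp_coord ε e (J a)
  rw [inducedForm_coordForm]
  change _ = η (sharp ε e ∘ e.coord ∘ J)
  rw [hsharp, η.map_smul_univ]
  rfl

theorem isInducedOnForms_inducedForm : IsInducedOnForms (signedMetric ε e) (inducedForm ε e k) := by
  intro v w
  rw [inducedForm_wedgeCovectors, wedgeCovectors_apply, ← Matrix.det_transpose]
  congr 1
  ext i j
  simp [sharp_signedMetric]

variable {ε e}

theorem IsInducedOnForms.eq_inducedForm {G : LinearMap.BilinForm K (V [⋀^Fin k]→ₗ[K] K)}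
    (hG : IsInducedOnForms (signedMetric ε e) G) : G = inducedForm ε e k := by
  have hcoord (J : Fin k ↪o Fin n) : coordForm e J =
      wedgeCovectors fun i => signedMetric ε e (sharp ε e (e.coord (J i))) := by
    simp only [signedMetric_sharp, coordForm]
  refine LinearMap.ext fun η => linearMap_ext_coordForm e fun J => ?_
  suffices G.flip (coordForm e J) = (inducedForm ε e k).flip (coordForm e J) from
    DFunLike.congr_fun this η
  refine linearMap_ext_coordForm e fun I => ?_
  change G (coordForm e I) (coordForm e J) = inducedForm ε e k (coordForm e I) (coordForm e J)
  rw [hcoord I, hcoord J, hG, isInducedOnForms_inducedForm]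

theorem isHodgeDual_signedMetric_iff {vol : V [⋀^Fin (k + l)]→ₗ[K] K} {ψ : V [⋀^Fin k]→ₗ[K] K}
    {χ : V [⋀^Fin l]→ₗ[K] K} :
    IsHodgeDual (signedMetric ε e) vol ψ χ ↔ ∀ J : Fin l ↪o Fin n,
      wedge ψ (coordForm e J) = ((∏ a, ((ε (J a) : ℤ) : K)) * χ (e ∘ J)) • vol := by
  constructor
  · rintro ⟨G, hG, hvol⟩ J
    rw [hvol, hG.eq_inducedForm, inducedForm_coordForm]
  · refine fun h => ⟨inducedForm ε e l, isInducedOnForms_inducedForm ε e, fun φ => ?_⟩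
    rw [eq_sum_smul_coordForm e φ]
    simp only [← wedgeBilin_apply, map_sum, map_smul, Finset.sum_smul, smul_assoc] at h ⊢
    simp only [h, inducedForm_coordForm]

end SignedMetric

theorem FormTerms.isHodgeDual_toForm_iff {n k l : ℕ} {ε : Fin n → ℤˣ}
    {e : Module.Basis (Fin n) K V} (h : k + l = n) {L : FormTerms n k} {M : FormTerms n l}
    (hLM : ∀ J : Fin l ↪o Fin n, (L.mul [(1, J)]).coeff (Fin.cast h) =
      (∏ a, (ε (J a) : ℤ)) * M.coeff J) {χ : V [⋀^Fin l]→ₗ[K] K} :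
    IsHodgeDual (signedMetric ε e) (coordForm e (Fin.cast h)) (L.toForm e) χ ↔
      χ = M.toForm e := by
  subst h
  have hwedge (J : Fin l ↪o Fin (k + l)) : wedge (L.toForm e) (coordForm e J) =
      ((∏ a, ((ε (J a) : ℤ) : K)) * M.toForm e (e ∘ J)) • coordForm e id := by
    have hterm : toForm e [(1, J)] = coordForm e J := by simp [toForm_cons, toForm_nil]
    refine topForm_ext e ?_
    rw [← hterm, wedge_toForm, AlternatingMap.smul_apply, coordForm_id_self, smul_eq_mul, mul_one,
      toForm_apply_comp e M J.injective, ← Function.comp_id (⇑e),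
      toForm_apply_comp e _ Function.injective_id, ← Int.cast_prod, ← Int.cast_mul, ← hLM J]
    rfl
  rw [isHodgeDual_signedMetric_iff]
  refine ⟨fun hχ => alternatingMap_ext_orderEmb e fun J => ?_, ?_⟩
  · have hJ := congrArg (evalForm K e) ((hχ J).symm.trans (hwedge J))
    rw [map_smul, map_smul, evalForm_apply] at hJ
    change _ * coordForm e id e = _ * coordForm e id e at hJ
    rw [coordForm_id_self, mul_one, mul_one] at hJ
    refine mul_left_cancel₀ (Finset.prod_ne_zero_iff.2 fun a _ => ?_) hJ
    exact left_ne_zero_of_mul_eq_one (intUnit_cast_mul_self _)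
  · rintro rfl
    exact hwedge

/-- The bilinear form `(v, w) ↦ ((v ⌟ φ) ∧ (w ⌟ φ) ∧ φ) (u₁, u₂, …)`, which for the three-forms of
interest is a multiple of the induced metric. -/
def contractionForm {k : ℕ} (φ : V [⋀^Fin (k + 1)]→ₗ[K] K) (u : Fin (k + k + (k + 1)) → V) :
    LinearMap.BilinForm K V :=
  ((wedgeBilin K V k k).compl₁₂ φ.curryLeft φ.curryLeft).compr₂
    (evalForm K u ∘ₗ (wedgeBilin K V (k + k) (k + 1)).flip φ)

theorem contractionForm_apply {k : ℕ} (φ : V [⋀^Fin (k + 1)]→ₗ[K] K)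
    (u : Fin (k + k + (k + 1)) → V) (v w : V) :
    contractionForm φ u v w = wedge (wedge (φ.curryLeft v) (φ.curryLeft w)) φ u := rfl

theorem FormTerms.contractionForm_toForm {n k : ℕ} (e : Module.Basis (Fin n) K V)
    (L : FormTerms n (k + 1)) {J : Fin (k + k + (k + 1)) → Fin n} (hJ : Function.Injective J)
    (i j : Fin n) : contractionForm (L.toForm e) (e ∘ J) (e i) (e j) =
      (((L.contract i).mul (L.contract j)).mul L).coeff J := by
  rw [contractionForm_apply, curryLeft_toForm, curryLeft_toForm, wedge_toForm, wedge_toForm,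
    toForm_apply_comp e _ hJ]

end Forms

section G2

variable {K V : Type*} [Field K] [AddCommGroup V] [Module K V]

/-- The terms of the three-form `s e^{127} + s e^{347} + e^{567} + e^{135} - e^{146} - e^{236}
- e^{245}`, which is the `G₂`-form for `s = 1` and the `G₂*`-form for `s = -1`. -/
def phiTerms (s : ℤˣ) : FormTerms 7 3 :=
  [(s, ![0, 1, 6]), (s, ![2, 3, 6]), (1, ![4, 5, 6]), (1, ![0, 2, 4]), (-1, ![0, 3, 5]),
    (-1, ![1, 2, 5]), (-1, ![1, 3, 4])]

/-- The `G₂`-form (`s = 1`) or `G₂*`-form (`s = -1`) with adapted basis `e`. -/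
def phi (s : ℤˣ) (e : Module.Basis (Fin 7) K V) : V [⋀^Fin 3]→ₗ[K] K :=
  (phiTerms s).toForm e

/-- The terms of the Hodge dual of `phi s e`. -/
def psiTerms (s : ℤˣ) : FormTerms 7 4 :=
  [(1, ![0, 1, 2, 3]), (s, ![0, 1, 4, 5]), (1, ![0, 2, 5, 6]), (1, ![0, 3, 4, 6]),
    (1, ![1, 2, 4, 6]), (-1, ![1, 3, 5, 6]), (s, ![2, 3, 4, 5])]

/-- The Hodge dual of `phi s e`. -/
def psi (s : ℤˣ) (e : Module.Basis (Fin 7) K V) : V [⋀^Fin 4]→ₗ[K] K :=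
  (psiTerms s).toForm e

/-- The signs of the metric induced by `phi s e` on the adapted basis `e`. -/
def metricSign (s : ℤˣ) (i : Fin 7) : ℤˣ := if i < 4 then s else 1

theorem phi_one (e : Module.Basis (Fin 7) K V) : phi 1 e = g2Form e := by
  simp only [phi, phiTerms, FormTerms.toForm_cons, FormTerms.toForm_nil, g2Form]
  push_cast
  module

theorem phi_neg_one (e : Module.Basis (Fin 7) K V) : phi (-1) e = g2StarForm e := by
  simp only [phi, phiTerms, FormTerms.toForm_cons, FormTerms.toForm_nil, g2StarForm]
  push_cast
  module

theorem phiTerms_contract_mul_contract_mul : ∀ (s : ℤˣ) (i j : Fin 7),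
    ((((phiTerms s).contract i).mul ((phiTerms s).contract j)).mul (phiTerms s)).coeff id =
      if j = i then 6 * (metricSign s i : ℤ) else 0 := by
  decide +kernel

theorem phiTerms_mul_eq_psiTerms_coeff : ∀ s : ℤˣ, ∀ i j, i < j → ∀ k, j < k → ∀ l, k < l →
    ((phiTerms s).mul (l := 4) [(1, ![i, j, k, l])]).coeff id =
      (∏ a, (metricSign s (![i, j, k, l] a) : ℤ)) * (psiTerms s).coeff ![i, j, k, l] := by
  decide +kernel

theorem contractionForm_phi (s : ℤˣ) (e : Module.Basis (Fin 7) K V) :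
    contractionForm (phi s e) e = (6 : K) • signedMetric (metricSign s) e := by
  have hid : contractionForm (phi s e) e = contractionForm (phi s e) (e ∘ id) := rfl
  refine hid.trans (LinearMap.BilinForm.ext_basis e fun i j => ?_)
  rw [phi, FormTerms.contractionForm_toForm e _ Function.injective_id,
    phiTerms_contract_mul_contract_mul]
  rw [LinearMap.smul_apply, LinearMap.smul_apply, signedMetric_apply_basis]
  by_cases h : i = j <;> simp [h, eq_comm]

theorem metricRelation_phi_iff [CharZero K] {s : ℤˣ} {e : Module.Basis (Fin 7) K V}
    {g : LinearMap.BilinForm K V} {vol : V [⋀^Fin 7]→ₗ[K] K} :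
    MetricRelation (phi s e) g vol ↔ vol e • g = signedMetric (metricSign s) e := by
  rw [LinearMap.ext_iff₂]
  refine forall₂_congr fun v w => (topForm_ext_iff e).trans ?_
  have h6 : signedMetric (metricSign s) e v w = (6 : K)⁻¹ * contractionForm (phi s e) e v w := by
    rw [contractionForm_phi, LinearMap.smul_apply, LinearMap.smul_apply, smul_eq_mul,
      inv_mul_cancel_left₀ (by norm_num)]
  rw [h6, contractionForm_apply, AlternatingMap.smul_apply, LinearMap.smul_apply,
    LinearMap.smul_apply, smul_eq_mul, smul_eq_mul, mul_comm,
    ← evalForm_apply e ((6 : K)⁻¹ • _), map_smul, evalForm_apply, smul_eq_mul]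

theorem isHodgeDual_phi_iff {s : ℤˣ} {e : Module.Basis (Fin 7) K V} {χ : V [⋀^Fin 4]→ₗ[K] K} :
    IsHodgeDual (k := 3) (l := 4) (signedMetric (metricSign s) e) (coordForm e id) (phi s e) χ ↔
      χ = psi s e := by
  refine FormTerms.isHodgeDual_toForm_iff rfl fun J => ?_
  have hJ : ![J 0, J 1, J 2, J 3] = J := by ext i; fin_cases i <;> rfl
  have hcoeff := phiTerms_mul_eq_psiTerms_coeff s (J 0) (J 1) (J.lt_iff_lt.2 (by decide)) (J 2)
    (J.lt_iff_lt.2 (by decide)) (J 3) (J.lt_iff_lt.2 (by decide))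
  rwa [hJ] at hcoeff

end G2

section Derivation

variable {K V : Type*} [Field K] [AddCommGroup V] [Module K V]

/-- The action of an endomorphism `A` on forms as a derivation, normalised so that a covector `α`
is mapped to `α ∘ A`. -/
def derivForm {k : ℕ} (A : Module.End K V) (η : V [⋀^Fin (k + 1)]→ₗ[K] K) :
    V [⋀^Fin (k + 1)]→ₗ[K] K :=
  AlternatingMap.alternatizeUncurryFin (η.curryLeft ∘ₗ A)

theorem derivForm_apply {k : ℕ} (A : Module.End K V) (η : V [⋀^Fin (k + 1)]→ₗ[K] K)
    (v : Fin (k + 1) → V) : derivForm A η v = ∑ i, η (Function.update v i (A (v i))) := by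
  rw [derivForm, AlternatingMap.alternatizeUncurryFin_apply]
  refine Finset.sum_congr rfl fun i _ => ?_
  rw [LinearMap.comp_apply, AlternatingMap.curryLeft_apply_apply,
    ← AlternatingMap.neg_one_pow_smul_map_insertNth, smul_smul, ← mul_pow, neg_one_mul, neg_neg,
    one_pow, one_smul, Fin.insertNth_removeNth]

theorem derivForm_covectorWedge {k : ℕ} (A : Module.End K V) (α : Module.Dual K V)
    (η : V [⋀^Fin (k + 1)]→ₗ[K] K) :
    derivForm A (covectorWedge α η) =
      covectorWedge (α ∘ₗ A) η + covectorWedge α (derivForm A η) := by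
  ext v
  simp only [derivForm_apply, covectorWedge_apply, AlternatingMap.add_apply]
  rw [Finset.sum_comm, ← Finset.sum_add_distrib]
  refine Finset.sum_congr rfl fun p _ => ?_
  rw [Fin.sum_univ_succAbove _ p]
  simp only [Function.update_self, Fin.removeNth_update, ne_eq, Fin.ne_succAbove,
    not_false_eq_true, Function.update_of_ne, Fin.removeNth_update_succAbove, LinearMap.comp_apply,
    Finset.mul_sum]
  rfl

theorem derivForm_top {n : ℕ} (e : Module.Basis (Fin (n + 1)) K V) (A : Module.End K V)
    (ω : V [⋀^Fin (n + 1)]→ₗ[K] K) : derivForm A ω = LinearMap.trace K V A • ω := by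
  have hdet (i : Fin (n + 1)) (w : V) : e.det (Function.update e i w) = e.repr w i := by
    rw [e.det_apply, e.toMatrix_update, e.toMatrix_self, ← Matrix.cramer_apply,
      Matrix.cramer_one]
    rfl
  refine topForm_ext e ?_
  rw [ω.eq_smul_basis_det e, derivForm_apply, LinearMap.trace_eq_matrix_trace K e]
  simp [Matrix.trace, LinearMap.toMatrix_apply, hdet, e.det_self, Finset.sum_mul, mul_comm]

theorem eq_zero_of_forall_covectorWedge_eq_zero {n k : ℕ} (e : Module.Basis (Fin n) K V)
    (hk : k < n) {η : V [⋀^Fin k]→ₗ[K] K} (h : ∀ α, covectorWedge α η = 0) : η = 0 := by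
  refine alternatingMap_ext_orderEmb e fun J => ?_
  obtain ⟨i, hi⟩ : ∃ i, ∀ a, J a ≠ i := by
    by_contra! hsurj
    exact hk.not_ge (by simpa using Fintype.card_le_of_surjective J hsurj)
  have heval := congrArg (evalForm K (Fin.cons (e i) (e ∘ J))) (h (e.coord i))
  rw [evalForm_apply, covectorWedge_apply, Fin.sum_univ_succ] at heval
  simpa [hi, evalForm_apply] using heval

theorem wedgeCovectors_comp_equiv {k l : ℕ} (σ : Fin k ≃ Fin l) (α : Fin l → Module.Dual K V)
    (v : Fin l → V) : wedgeCovectors (α ∘ σ) (v ∘ σ) = wedgeCovectors α v :=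
  Matrix.det_submatrix_equiv_self σ (Matrix.of fun i j => α j (v i))

theorem wedge_wedgeCovectors_three {n k : ℕ} (e : Module.Basis (Fin n) K V)
    (α β γ : Module.Dual K V) (η : V [⋀^Fin k]→ₗ[K] K) (v : Fin (k + 3) → V) :
    wedge (wedgeCovectors ![α, β, γ]) η (v ∘ finCongr (Nat.add_comm 3 k)) =
      covectorWedge α (covectorWedge β (covectorWedge γ η)) v := by
  suffices evalForm K (v ∘ finCongr (Nat.add_comm 3 k)) ∘ₗ
      wedgeBilin K V 3 k (wedgeCovectors ![α, β, γ]) =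
        evalForm K v ∘ₗ covectorWedge α ∘ₗ covectorWedge β ∘ₗ covectorWedge γ from
    LinearMap.congr_fun this η
  refine linearMap_ext_coordForm e fun J => ?_
  have happend (δ : Fin k → Module.Dual K V) : Fin.append ![α, β, γ] δ =
      (Fin.cons α (Fin.cons β (Fin.cons γ δ)) : Fin (k + 3) → _) ∘ finCongr (Nat.add_comm 3 k) := by
    funext i
    refine Fin.addCases (fun i => ?_) (fun j => ?_) i
    · rw [Fin.append_left]
      fin_cases i <;> rfl
    · rw [Fin.append_right, Function.comp_apply,
        show finCongr (Nat.add_comm 3 k) (Fin.natAdd 3 j) = j.succ.succ.succ from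
          Fin.ext (Nat.add_comm 3 j)]
      rfl
  simp only [LinearMap.comp_apply, wedgeBilin_apply, evalForm_apply, coordForm,
    wedge_wedgeCovectors, covectorWedge_wedgeCovectors, happend, wedgeCovectors_comp_equiv]

/-- Applying the derivation `A` to `α ∧ β ∧ ξ ∧ Ψ`, on which it acts as multiplication by `tr A`,
shows that `ξ ∧ (A · Ψ) = 0` is an eigenvalue equation for the bivector dual to `ξ ∧ Ψ`. -/
theorem covectorWedge_derivForm_eq_zero_iff {n k : ℕ} (hk : 3 + (k + 1) = n)
    (e : Module.Basis (Fin n) K V) {A : Module.End K V} {ξ : Module.Dual K V} (hA : ξ ∘ₗ A = 0)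
    {Ψ : V [⋀^Fin (k + 1)]→ₗ[K] K} {B : LinearMap.BilinForm K (Module.Dual K V)}
    (hB : ∀ α β, B α β = wedge (wedgeCovectors ![α, β, ξ]) Ψ (e ∘ Fin.cast hk)) :
    covectorWedge ξ (derivForm A Ψ) = 0 ↔
      ∀ α β, B (α ∘ₗ A) β + B α (β ∘ₗ A) = LinearMap.trace K V A * B α β := by
  subst hk
  let b := e.reindex (finCongr (Nat.add_comm 3 (k + 1)))
  have he : ⇑e ∘ Fin.cast rfl = b ∘ finCongr (Nat.add_comm 3 (k + 1)) := by
    ext i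
    simp [b]
  simp only [he, wedge_wedgeCovectors_three b] at hB
  have hderiv : derivForm A (covectorWedge ξ Ψ) = covectorWedge ξ (derivForm A Ψ) := by
    rw [derivForm_covectorWedge, hA, map_zero, LinearMap.zero_apply, zero_add]
  have hleibniz (α β : Module.Dual K V) : LinearMap.trace K V A * B α β =
      B (α ∘ₗ A) β + B α (β ∘ₗ A) +
        covectorWedge α (covectorWedge β (covectorWedge ξ (derivForm A Ψ))) b := by
    have h := derivForm_top b A (covectorWedge α (covectorWedge β (covectorWedge ξ Ψ)))
    rw [derivForm_covectorWedge, derivForm_covectorWedge, hderiv, map_add, ← add_assoc] at h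
    rw [hB, hB, hB]
    exact (congrArg (evalForm K b) h).symm
  constructor
  · intro h α β
    rw [hleibniz, h, map_zero, map_zero, AlternatingMap.zero_apply, add_zero]
  · intro h
    refine eq_zero_of_forall_covectorWedge_eq_zero b (by lia) fun β =>
      eq_zero_of_forall_covectorWedge_eq_zero b (by lia) fun α => topForm_ext b ?_
    exact left_eq_add.1 ((h α β).trans (hleibniz α β))

end Derivation

section LieDerivative

variable {K 𝔤 : Type*} [Field K] [LieRing 𝔤] [LieAlgebra K 𝔤]

/-- The bracket of a Lie algebra with an abelian ideal of codimension one: the ideal is `ker ξ`,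
and `A` is the adjoint action of a vector `u` with `ξ u = 1`. -/
structure IsAlmostAbelianBracket (ξ : Module.Dual K 𝔤) (A : Module.End K 𝔤) : Prop where
  lie_eq : ∀ v w : 𝔤, ⁅v, w⁆ = ξ v • A w - ξ w • A v
  comp_eq_zero : ξ ∘ₗ A = 0

theorem IsAlmostAbelianBracket.lieExtDeriv_apply {k : ℕ} {ξ : Module.Dual K 𝔤}
    {A : Module.End K 𝔤} (h : IsAlmostAbelianBracket ξ A)
    (η : 𝔤 [⋀^Fin (k + 1)]→ₗ[K] K) (v : Fin (k + 2) → 𝔤) :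
    lieExtDeriv η v = -covectorWedge ξ (derivForm A η) v := by
  let f : 𝔤 →ₗ[K] 𝔤 →ₗ[K] 𝔤 [⋀^Fin k]→ₗ[K] K := ξ.smulRight (η.curryLeft ∘ₗ A)
  have hf : covectorWedge ξ (derivForm A η) =
      AlternatingMap.alternatizeUncurryFin (AlternatingMap.alternatizeUncurryFinLM ∘ₗ f) := by
    refine congrArg AlternatingMap.alternatizeUncurryFin (LinearMap.ext fun u => ?_)
    simp [f, derivForm]
  have hbracket (x y : 𝔤) (w : Fin k → 𝔤) : f x y w - f y x w = η (Matrix.vecCons ⁅x, y⁆ w) := by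
    rw [← AlternatingMap.curryLeft_apply_apply, h.lie_eq, map_sub, map_smul, map_smul]
    rfl
  rw [hf, AlternatingMap.alternatizeUncurryFin_alternatizeUncurryFinLM_comp_apply, lieExtDeriv,
    Fin.sum_univ_succ, Finset.sum_comm, ← Finset.sum_neg_distrib]
  simp only [Fin.not_lt_zero, if_false, Finset.sum_const_zero, zero_add]
  refine Finset.sum_congr rfl fun i _ => ?_
  rw [← Finset.sum_neg_distrib, ← Finset.filter_le_eq_Ici, Finset.sum_filter]
  refine Finset.sum_congr rfl fun j _ => ?_
  simp only [Fin.castSucc_lt_succ_iff]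
  split_ifs with hij
  · have hswap : j.removeNth (i.castSucc.removeNth v) = i.removeNth (j.succ.removeNth v) := by
      rw [Fin.removeNth_removeNth_eq_swap, Fin.succAbove_of_le_castSucc _ _ hij,
        Fin.predAbove_of_le_castSucc _ _ hij, Fin.castPred_castSucc]
    rw [hswap, Fin.val_succ, ← add_assoc, pow_succ, mul_neg_one, neg_mul, hbracket]
    simp [Matrix.vecCons]
  · rfl

end LieDerivative

section Bivector

variable {K V : Type*} [Field K] [AddCommGroup V] [Module K V]

theorem coordForm_mul_psiTerms_coeff : ∀ s : ℤˣ, ∀ i j, i < j → ∀ k, j < k →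
    (FormTerms.mul (k := 3) [(1, ![i, j, k])] (psiTerms s)).coeff id =
      (phiTerms s).coeff ![i, j, k] := by
  decide +kernel

theorem FormTerms.wedge_wedgeCovectors_toForm {n k l : ℕ} (h : k + l = n) {M : FormTerms n l}
    {N : FormTerms n k}
    (hMN : ∀ J : Fin k ↪o Fin n, (FormTerms.mul [(1, J)] M).coeff (Fin.cast h) = N.coeff J)
    (e : Module.Basis (Fin n) K V) (α : Fin k → Module.Dual K V) :
    wedge (wedgeCovectors α) (M.toForm e) (e ∘ Fin.cast h) = N.toForm e.dualBasis α := by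
  subst h
  let f : Module.Dual K (V [⋀^Fin k]→ₗ[K] K) :=
    evalForm K e ∘ₗ (wedgeBilin K V k l).flip (M.toForm e)
  suffices hf : ∀ J : Fin k ↪o Fin (k + l), f (coordForm e J) = N.toForm e.dualBasis (e.coord ∘ J)
    from apply_wedgeCovectors_eq_of_coordForm e hf α
  intro J
  have hterm : toForm e [(1, J)] = coordForm e J := by simp [toForm_cons, toForm_nil]
  rw [← e.coe_dualBasis, toForm_apply_comp _ _ J.injective, ← hMN, ← hterm]
  change wedge (toForm e [(1, J)]) (M.toForm e) (e ∘ id) = _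
  rw [wedge_toForm, toForm_apply_comp e _ Function.injective_id]
  rfl

theorem wedge_wedgeCovectors_psi (s : ℤˣ) (e : Module.Basis (Fin 7) K V)
    (α : Fin 3 → Module.Dual K V) :
    wedge (wedgeCovectors α) (psi s e) (e ∘ Fin.cast rfl) = phi s e.dualBasis α := by
  have hcoeff (J : Fin 3 ↪o Fin 7) :
      (FormTerms.mul [(1, J)] (psiTerms s)).coeff id = (phiTerms s).coeff J := by
    have hJ : ![J 0, J 1, J 2] = J := by ext i; fin_cases i <;> rfl
    rw [← hJ]
    exact coordForm_mul_psiTerms_coeff s (J 0) (J 1) (J.lt_iff_lt.2 (by decide)) (J 2)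
      (J.lt_iff_lt.2 (by decide))
  have hwedge := FormTerms.wedge_wedgeCovectors_toForm (n := 7) (k := 3) (l := 4) rfl hcoeff e α
  rw [phi, psi]
  with_reducible exact hwedge

/-- The bivector obtained from the two-form `ξ^♯ ⌟ phi s e` by raising indices. -/
def phiBivec (s : ℤˣ) (e : Module.Basis (Fin 7) K V) (ξ : Module.Dual K V) :
    LinearMap.BilinForm K (Module.Dual K V) :=
  (AlternatingMap.curryLeftLinearMap ∘ₗ (phi s e.dualBasis).curryLeft).compr₂ (evalForm K ![ξ])

theorem phiBivec_apply (s : ℤˣ) (e : Module.Basis (Fin 7) K V) (ξ α β : Module.Dual K V) :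
    phiBivec s e ξ α β = phi s e.dualBasis ![α, β, ξ] := rfl

theorem phiBivec_isAlt (s : ℤˣ) (e : Module.Basis (Fin 7) K V) (ξ : Module.Dual K V) :
    (phiBivec s e ξ).IsAlt := fun α =>
  (phi s e.dualBasis).map_eq_zero_of_eq ![α, α, ξ] (i := 0) (j := 1) rfl (by decide)

theorem phiBivec_self_left (s : ℤˣ) (e : Module.Basis (Fin 7) K V) (ξ : Module.Dual K V) :
    phiBivec s e ξ ξ = 0 :=
  LinearMap.ext fun α =>
    (phi s e.dualBasis).map_eq_zero_of_eq ![ξ, α, ξ] (i := 0) (j := 2) rfl (by decide)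

/-- `B` is a bivector on `V`, in the form of an alternating bilinear form on covectors; it lies in
`Λ² (ker ξ)`, and is an eigenvector of `A` for the eigenvalue `tr A`. -/
structure IsTraceBivector (A : Module.End K V) (ξ : Module.Dual K V)
    (B : LinearMap.BilinForm K (Module.Dual K V)) : Prop where
  alt : B.IsAlt
  left : B ξ = 0
  trace : ∀ α β, B (α ∘ₗ A) β + B α (β ∘ₗ A) = LinearMap.trace K V A * B α β

end Bivector

section LieAlgebra

variable {K 𝔤 : Type*} [Field K] [LieRing 𝔤] [LieAlgebra K 𝔤]

theorem IsAlmostAbelianBracket.lieExtDeriv_psi_eq_zero_iff {ξ : Module.Dual K 𝔤}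
    {A : Module.End K 𝔤} (h : IsAlmostAbelianBracket ξ A) (s : ℤˣ)
    (e : Module.Basis (Fin 7) K 𝔤) :
    lieExtDeriv (psi s e) = 0 ↔ IsTraceBivector A ξ (phiBivec s e ξ) := by
  have hzero : lieExtDeriv (psi s e) = 0 ↔ covectorWedge ξ (derivForm A (psi s e)) = 0 := by
    rw [funext_iff, AlternatingMap.ext_iff]
    simp [h.lieExtDeriv_apply]
  have hdual (α β : Module.Dual K 𝔤) : phiBivec s e ξ α β =
      wedge (wedgeCovectors ![α, β, ξ]) (psi s e) (e ∘ Fin.cast rfl) := by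
    rw [phiBivec_apply, wedge_wedgeCovectors_psi]
  have hclosed := covectorWedge_derivForm_eq_zero_iff (n := 7) (k := 3) (Ψ := psi s e)
    (B := phiBivec s e ξ) rfl e h.comp_eq_zero (by with_reducible exact hdual)
  rw [hzero, hclosed]
  exact ⟨fun htrace => ⟨phiBivec_isAlt s e ξ, phiBivec_self_left s e ξ, htrace⟩,
    fun hB => hB.trace⟩

end LieAlgebra

section Rank

variable {K V : Type*} [Field K] [AddCommGroup V] [Module K V]

/-- The Pfaffian `(B ∧ B)(α, β, γ, δ) / 2` of an alternating bilinear form. -/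
def pfaffian4 {W : Type*} [AddCommGroup W] [Module K W] (B : LinearMap.BilinForm K W)
    (α β γ δ : W) : K :=
  B α β * B γ δ - B α γ * B β δ + B α δ * B β γ

theorem phiBivec_apply_eq_sum (s : ℤˣ) (e : Module.Basis (Fin 7) K V) (ξ α β : Module.Dual K V) :
    let minor (a b c : Fin 7) : K := !![α (e a), α (e b), α (e c); β (e a), β (e b), β (e c);
      ξ (e a), ξ (e b), ξ (e c)].det
    phiBivec s e ξ α β = ((s : ℤ) : K) * minor 0 1 6 + ((s : ℤ) : K) * minor 2 3 6 + minor 4 5 6 +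
      minor 0 2 4 - minor 0 3 5 - minor 1 2 5 - minor 1 3 4 := by
  simp only [phiBivec_apply, phi, phiTerms, FormTerms.toForm_cons, FormTerms.toForm_nil,
    AlternatingMap.add_apply, AlternatingMap.smul_apply, AlternatingMap.zero_apply, coordForm,
    wedgeCovectors_apply, Matrix.det_fin_three]
  simp only [Module.Basis.coord_apply, Module.Basis.dualBasis_repr, Matrix.of_apply,
    Matrix.cons_val_zero, Matrix.cons_val_one, Matrix.cons_val, Matrix.cons_val',
    Matrix.cons_val_fin_one, smul_eq_mul, Int.cast_one, Int.cast_neg]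
  ring

theorem phiBivec_coord_right (s : ℤˣ) (e : Module.Basis (Fin 7) K V) (ξ α : Module.Dual K V)
    (j : Fin 7) :
    let minor (a b : Fin 7) : K := ξ (e a) * α (e b) - ξ (e b) * α (e a)
    phiBivec s e ξ α (e.coord j) =
      ![((s : ℤ) : K) * minor 1 6 + minor 2 4 - minor 3 5,
        -(((s : ℤ) : K) * minor 0 6) - minor 2 5 - minor 3 4,
        ((s : ℤ) : K) * minor 3 6 - minor 0 4 + minor 1 5,
        -(((s : ℤ) : K) * minor 2 6) + minor 0 5 + minor 1 4,
        minor 5 6 + minor 0 2 - minor 1 3,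
        -minor 4 6 - minor 0 3 - minor 1 2,
        ((s : ℤ) : K) * minor 0 1 + ((s : ℤ) : K) * minor 2 3 + minor 4 5] j := by
  simp only [phiBivec_apply_eq_sum, Matrix.det_fin_three]
  fin_cases j <;> simp <;> ring

/-- For unit covectors this is the norm of the cross product `α × ξ`, polarised in `α`. -/
theorem sum_phiBivec_mul_phiBivec (s : ℤˣ) (e : Module.Basis (Fin 7) K V)
    (ξ α β : Module.Dual K V) :
    ∑ j, ((metricSign s j : ℤ) : K) *
        (phiBivec s e ξ α (e.coord j) * phiBivec s e ξ β (e.coord j)) =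
      ξ (sharp (metricSign s) e ξ) * α (sharp (metricSign s) e β) -
        ξ (sharp (metricSign s) e α) * ξ (sharp (metricSign s) e β) := by
  simp only [phiBivec_coord_right, sharp, Fin.sum_univ_seven, metricSign]
  rcases Int.units_eq_one_or s with rfl | rfl <;> simp <;> ring

theorem phiBivec_radical {s : ℤˣ} {e : Module.Basis (Fin 7) K V} {ξ α : Module.Dual K V}
    (hξ : ξ (sharp (metricSign s) e ξ) ≠ 0) (hα : phiBivec s e ξ α = 0) : ∃ c : K, α = c • ξ := by
  refine ⟨(ξ (sharp (metricSign s) e ξ))⁻¹ * ξ (sharp (metricSign s) e α), e.ext fun m => ?_⟩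
  have hnorm := sum_phiBivec_mul_phiBivec s e ξ α (e.coord m)
  have hm := left_ne_zero_of_mul_eq_one (intUnit_cast_mul_self (K := K) (metricSign s m))
  simp only [hα, LinearMap.zero_apply, zero_mul, mul_zero, Finset.sum_const_zero, sharp_coord,
    map_smul, smul_eq_mul] at hnorm
  rw [LinearMap.smul_apply, smul_eq_mul, mul_assoc, eq_inv_mul_iff_mul_eq₀ hξ]
  refine mul_left_cancel₀ hm ?_
  linear_combination -hnorm

/-- The index sets of the terms of `psi` are the complements of the lines of the Fano plane. -/
theorem pfaffian4_phiBivec (s : ℤˣ) (e : Module.Basis (Fin 7) K V) (ξ : Module.Dual K V) :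
    ∀ t ∈ psiTerms s, (t.1 : K) * pfaffian4 (phiBivec s e ξ) (e.coord (t.2 0))
        (e.coord (t.2 1)) (e.coord (t.2 2)) (e.coord (t.2 3)) =
      ∑ i with ∀ a, t.2 a ≠ i, ((metricSign s i : ℤ) : K) * ξ (e i) ^ 2 := by
  simp only [Finset.sum_filter, Fin.sum_univ_seven, psiTerms, List.forall_mem_cons, pfaffian4,
    phiBivec_coord_right, Fin.forall_fin_succ]
  rcases Int.units_eq_one_or s with rfl | rfl <;>
    refine ⟨?_, ?_, ?_, ?_, ?_, ?_, ?_, by simp⟩ <;> simp [metricSign] <;> ring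

theorem eq_zero_of_sum_fano_lines_eq_zero [CharZero K] {s : ℤˣ} {q : Fin 7 → K}
    (hq : ∀ t ∈ psiTerms s, ∑ i with ∀ a, t.2 a ≠ i, q i = 0) (i : Fin 7) : q i = 0 := by
  obtain ⟨h456, h236, h134, h125, h035, h024, h016⟩ : q 4 + q 5 + q 6 = 0 ∧
      q 2 + q 3 + q 6 = 0 ∧ q 1 + q 3 + q 4 = 0 ∧ q 1 + q 2 + q 5 = 0 ∧ q 0 + q 3 + q 5 = 0 ∧
      q 0 + q 2 + q 4 = 0 ∧ q 0 + q 1 + q 6 = 0 := by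
    simpa [Finset.sum_filter, Fin.sum_univ_seven, psiTerms, Fin.forall_fin_succ] using hq
  have htotal : ∑ j, q j = 0 := by
    rw [Fin.sum_univ_seven]
    linear_combination (h456 + h236 + h134 + h125 + h035 + h024 + h016) / 3
  rw [Fin.sum_univ_seven] at htotal
  match i with
  | 0 => linear_combination (h016 + h024 + h035 - htotal) / 2
  | 1 => linear_combination (h016 + h125 + h134 - htotal) / 2
  | 2 => linear_combination (h236 + h024 + h125 - htotal) / 2
  | 3 => linear_combination (h236 + h035 + h134 - htotal) / 2
  | 4 => linear_combination (h456 + h024 + h134 - htotal) / 2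
  | 5 => linear_combination (h456 + h035 + h125 - htotal) / 2
  | 6 => linear_combination (h016 + h236 + h456 - htotal) / 2

theorem exists_pfaffian4_phiBivec_ne_zero [CharZero K] (s : ℤˣ) (e : Module.Basis (Fin 7) K V)
    {ξ : Module.Dual K V} (hξ : ξ ≠ 0) : ∃ α β γ δ, pfaffian4 (phiBivec s e ξ) α β γ δ ≠ 0 := by
  by_contra! hzero
  refine hξ (e.ext fun i => ?_)
  have hcoord : ((metricSign s i : ℤ) : K) * ξ (e i) ^ 2 = 0 :=
    eq_zero_of_sum_fano_lines_eq_zero (s := s)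
      (q := fun j => ((metricSign s j : ℤ) : K) * ξ (e j) ^ 2)
      (fun t ht => by rw [← pfaffian4_phiBivec s e ξ t ht, hzero, mul_zero]) i
  have hi := left_ne_zero_of_mul_eq_one (intUnit_cast_mul_self (K := K) (metricSign s i))
  simpa [hi] using hcoord

end Rank

section SignedMetric

variable {K V : Type*} [Field K] [AddCommGroup V] [Module K V] {n : ℕ}

theorem toMatrix_signedMetric (ε : Fin n → ℤˣ) (e : Module.Basis (Fin n) K V) :
    LinearMap.BilinForm.toMatrix e (signedMetric ε e) =
      Matrix.diagonal fun i => ((ε i : ℤ) : K) := by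
  ext i j
  by_cases h : i = j <;> simp [signedMetric_apply_basis, h]

theorem det_toMatrix_signedMetric (ε : Fin n → ℤˣ) (e f : Module.Basis (Fin n) K V) :
    (LinearMap.BilinForm.toMatrix f (signedMetric ε e)).det =
      (∏ i, ((ε i : ℤ) : K)) * coordForm e id f ^ 2 := by
  rw [← LinearMap.BilinForm.toMatrix_mul_basis_toMatrix e f, toMatrix_signedMetric,
    Matrix.det_mul, Matrix.det_mul, Matrix.det_transpose, Matrix.det_diagonal,
    coordForm_id_eq_det, e.det_apply]
  ring

theorem signedMetric_restrict_ker_nondegenerate_iff {ε : Fin n → ℤˣ}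
    {e : Module.Basis (Fin n) K V} {ξ : Module.Dual K V} (hξ : ξ ≠ 0) :
    ((signedMetric ε e).restrict (LinearMap.ker ξ)).Nondegenerate ↔ ξ (sharp ε e ξ) ≠ 0 := by
  have hsharp (v : V) : signedMetric ε e (sharp ε e ξ) v = ξ v := by rw [signedMetric_sharp]
  have hsymm : ((signedMetric ε e).restrict (LinearMap.ker ξ)).IsRefl := fun v w h => by
    rw [LinearMap.BilinForm.restrict_apply, LinearMap.domRestrict_apply, signedMetric_comm] at h
    exact h
  refine hsymm.nondegenerate_iff_separatingLeft.trans ⟨fun h hnull => hξ ?_, fun hnull u hu => ?_⟩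
  · have hzero : sharp ε e ξ = 0 :=
      congrArg Subtype.val (h ⟨sharp ε e ξ, hnull⟩ fun w => (hsharp w).trans w.2)
    rw [← signedMetric_sharp ε e ξ, hzero, map_zero]
  · have horth : signedMetric ε e u (sharp ε e ξ) = 0 := by
      rw [signedMetric_comm, hsharp]
      exact u.2
    have hzero : signedMetric ε e u = 0 := by
      ext v
      have hker : v - (ξ v / ξ (sharp ε e ξ)) • sharp ε e ξ ∈ LinearMap.ker ξ := by
        rw [LinearMap.mem_ker, map_sub, map_smul, smul_eq_mul, div_mul_cancel₀ _ hnull, sub_self]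
      simpa [map_sub, horth] using hu ⟨_, hker⟩
    exact Subtype.ext (by rw [← sharp_signedMetric ε e u, hzero, map_zero]; rfl)

end SignedMetric

section InducedMetric

variable {K V : Type*} [Field K] [AddCommGroup V] [Module K V]

theorem prod_metricSign (s : ℤˣ) : ∏ i, metricSign s i = 1 := by
  revert s
  decide +kernel

theorem coordForm_id_smul_signedMetric_of_phi_eq [CharZero K] {s t : ℤˣ}
    {e f : Module.Basis (Fin 7) K V} (h : phi s e = phi t f) :
    coordForm e id f • signedMetric (metricSign s) e = signedMetric (metricSign t) f := by
  rw [← metricRelation_phi_iff, ← h, metricRelation_phi_iff, coordForm_id_self, one_smul]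

theorem coordForm_id_pow_nine_of_phi_eq [CharZero K] {s t : ℤˣ} {e f : Module.Basis (Fin 7) K V}
    (h : phi s e = phi t f) : coordForm e id f ^ 9 = 1 := by
  have hprod (u : ℤˣ) : ∏ i, ((metricSign u i : ℤ) : K) = 1 := by
    rw [← Int.cast_prod, ← Units.coe_prod, prod_metricSign, Units.val_one, Int.cast_one]
  have hdet := det_toMatrix_signedMetric (metricSign t) f f
  rw [← coordForm_id_smul_signedMetric_of_phi_eq h, map_smul, Matrix.det_smul, Fintype.card_fin,
    det_toMatrix_signedMetric, hprod, hprod, coordForm_id_self] at hdet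
  linear_combination hdet

theorem coordForm_id_eq_of_phi_eq [LinearOrder K] [IsStrictOrderedRing K] {s t : ℤˣ}
    {e f : Module.Basis (Fin 7) K V} (h : phi s e = phi t f) : coordForm e id = coordForm f id := by
  rw [eq_coordForm_id_iff, ← Odd.pow_inj (n := 9) ⟨4, rfl⟩, one_pow]
  exact coordForm_id_pow_nine_of_phi_eq h

theorem signedMetric_eq_of_phi_eq [LinearOrder K] [IsStrictOrderedRing K] {s t : ℤˣ}
    {e f : Module.Basis (Fin 7) K V} (h : phi s e = phi t f) :
    signedMetric (metricSign s) e = signedMetric (metricSign t) f := by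
  rw [← coordForm_id_smul_signedMetric_of_phi_eq h, coordForm_id_eq_of_phi_eq h, coordForm_id_self,
    one_smul]

theorem exists_eq_phi_iff {φ : V [⋀^Fin 3]→ₗ[K] K} {e : Module.Basis (Fin 7) K V} :
    (∃ s, φ = phi s e) ↔ φ = g2Form e ∨ φ = g2StarForm e := by
  constructor
  · rintro ⟨s, rfl⟩
    rcases Int.units_eq_one_or s with rfl | rfl
    · exact Or.inl (phi_one e)
    · exact Or.inr (phi_neg_one e)
  · rintro (rfl | rfl)
    · exact ⟨1, (phi_one e).symm⟩
    · exact ⟨-1, (phi_neg_one e).symm⟩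

theorem abs_signedMetric_apply_basis [LinearOrder K] [IsStrictOrderedRing K] {n : ℕ}
    (ε : Fin n → ℤˣ) (e : Module.Basis (Fin n) K V) (i j : Fin n) :
    |signedMetric ε e (e i) (e j)| = if i = j then 1 else 0 := by
  rw [signedMetric_apply_basis]
  rcases Int.units_eq_one_or (ε j) with hsign | hsign <;>
    simp [hsign, Finsupp.single_apply, apply_ite abs]

theorem isInducedMetric_phi_iff {V : Type*} [AddCommGroup V] [Module ℝ V] {s : ℤˣ}
    {e : Module.Basis (Fin 7) ℝ V} {g : LinearMap.BilinForm ℝ V} {vol : V [⋀^Fin 7]→ₗ[ℝ] ℝ} :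
    IsInducedMetric (phi s e) g vol ↔
      g = signedMetric (metricSign s) e ∧ vol = coordForm e id := by
  constructor
  · intro h
    have hvol : vol e = 1 := (h.orthonormal e (exists_eq_phi_iff.1 ⟨s, rfl⟩)).1
    have hg := metricRelation_phi_iff.1 h.relation
    rw [hvol, one_smul] at hg
    exact ⟨hg, eq_coordForm_id_iff.2 hvol⟩
  · rintro ⟨hg, hvol⟩
    refine ⟨metricRelation_phi_iff.2 (by rw [hg, hvol, coordForm_id_self, one_smul]),
      fun f hf => ?_⟩
    obtain ⟨t, ht⟩ := exists_eq_phi_iff.2 hf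
    have hvolf : vol f = 1 := eq_coordForm_id_iff.1 (hvol.trans (coordForm_id_eq_of_phi_eq ht))
    rw [hg, signedMetric_eq_of_phi_eq ht]
    exact ⟨hvolf, abs_signedMetric_apply_basis (metricSign t) f⟩

end InducedMetric

section LieAlgebra

variable {K 𝔤 : Type*} [Field K] [LieRing 𝔤] [LieAlgebra K 𝔤] {ξ : Module.Dual K 𝔤}
  {A : Module.End K 𝔤}

theorem IsAlmostAbelianBracket.hasClosedHodgeDual_phi_iff (h : IsAlmostAbelianBracket ξ A)
    (s : ℤˣ) (e : Module.Basis (Fin 7) K 𝔤) :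
    HasClosedHodgeDual (signedMetric (metricSign s) e) (coordForm e id) (phi s e) ↔
      IsTraceBivector A ξ (phiBivec s e ξ) := by
  rw [← h.lieExtDeriv_psi_eq_zero_iff, HasClosedHodgeDual]
  simp only [isHodgeDual_phi_iff, exists_eq_left]

end LieAlgebra

section Minors

variable {K V W : Type*} [Field K] [AddCommGroup V] [Module K V] [AddCommGroup W] [Module K W]
  {r : ℕ}

theorem wedgeCovectors_ne_zero_iff {α : Fin r → Module.Dual K V} :
    wedgeCovectors α ≠ 0 ↔ LinearIndependent K α := by
  constructor
  · intro hα
    obtain ⟨v, hv⟩ := DFunLike.ne_iff.1 hα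
    rw [wedgeCovectors_apply, ← Matrix.det_transpose] at hv
    exact (Matrix.linearIndependent_rows_of_det_ne_zero hv).of_comp
      (LinearMap.pi fun j => Module.Dual.eval K V (v j))
  · intro hα hzero
    have hfun : LinearIndependent K fun j => (α j : V → K) :=
      hα.map' (LinearMap.ltoFun K V K K) (LinearMap.ker_eq_bot.2 DFunLike.coe_injective)
    have hsurj : Function.Surjective (LinearMap.pi α) := by
      rw [← LinearMap.range_eq_top, ← span_flip_eq_top_iff_linearIndependent.2 hfun,
        ← Submodule.span_eq (LinearMap.range (LinearMap.pi α))]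
      rfl
    choose v hv using fun i : Fin r => hsurj (Pi.single i 1)
    have hdet : wedgeCovectors α v = 1 := by
      rw [wedgeCovectors_apply, ← Matrix.det_one (n := Fin r)]
      congr 1
      ext i j
      rw [Matrix.one_eq_pi_single, ← hv]
      rfl
    rw [hzero] at hdet
    exact zero_ne_one hdet

theorem wedgeCovectors_flip_apply (B : W →ₗ[K] Module.Dual K V) (w : Fin r → W) (v : Fin r → V) :
    wedgeCovectors (B.flip ∘ v) w = wedgeCovectors (B ∘ w) v := by
  rw [wedgeCovectors_apply, ← Matrix.det_transpose]
  rfl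

theorem le_finrank_range_iff {M : Type*} [AddCommGroup M] [Module K M] [FiniteDimensional K W]
    {f : W →ₗ[K] M} :
    r ≤ Module.finrank K (LinearMap.range f) ↔ ∃ w : Fin r → W, LinearIndependent K (f ∘ w) := by
  constructor
  · intro hr
    obtain ⟨m, hm⟩ := exists_linearIndependent_of_le_finrank hr
    choose w hw using fun i => (m i).2
    have hcoe : f ∘ w = (LinearMap.range f).subtype ∘ m := funext hw
    exact ⟨w, hcoe ▸ hm.map' (LinearMap.range f).subtype (Submodule.ker_subtype _)⟩
  · rintro ⟨w, hw⟩
    have hrange : LinearIndependent K (f.rangeRestrict ∘ w) :=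
      LinearIndependent.of_comp (LinearMap.range f).subtype hw
    simpa using hrange.fintype_card_le_finrank

theorem le_finrank_range_iff_exists_minor [FiniteDimensional K W] {B : W →ₗ[K] Module.Dual K V} :
    r ≤ Module.finrank K (LinearMap.range B) ↔
      ∃ (w : Fin r → W) (v : Fin r → V), wedgeCovectors (B ∘ w) v ≠ 0 := by
  simp only [le_finrank_range_iff, ← wedgeCovectors_ne_zero_iff, DFunLike.ne_iff]
  rfl

theorem exists_apply_basis_ne_zero {ι : Type*} (e : Module.Basis ι K V)
    {ω : V [⋀^Fin r]→ₗ[K] K} (hω : ω ≠ 0) : ∃ I : Fin r → ι, ω (e ∘ I) ≠ 0 := by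
  by_contra! h
  exact hω (e.ext_alternating fun I _ => h I)

theorem exists_basis_minor_ne_zero [FiniteDimensional K W] {ι κ : Type*}
    (e : Module.Basis ι K W) (f : Module.Basis κ K V) {B : W →ₗ[K] Module.Dual K V}
    (hr : r ≤ Module.finrank K (LinearMap.range B)) :
    ∃ (I : Fin r → ι) (J : Fin r → κ), wedgeCovectors (B ∘ e ∘ I) (f ∘ J) ≠ 0 := by
  obtain ⟨w, v, h⟩ := le_finrank_range_iff_exists_minor.1 hr
  obtain ⟨J, hJ⟩ := exists_apply_basis_ne_zero f
    (ω := wedgeCovectors (B ∘ w)) fun hzero => h (by rw [hzero]; rfl)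
  rw [← wedgeCovectors_flip_apply] at hJ
  obtain ⟨I, hI⟩ := exists_apply_basis_ne_zero e
    (ω := wedgeCovectors (B.flip ∘ f ∘ J)) fun hzero => hJ (by rw [hzero]; rfl)
  exact ⟨I, J, by rwa [wedgeCovectors_flip_apply] at hI⟩

end Minors

section TraceBivectors

variable {K V : Type*} [Field K] [AddCommGroup V] [Module K V]

/-- There is a trace bivector of `A` on `ker ξ` of rank at least `r`. Which of the cocalibrated
structures exist depends on the Lie bracket only through this condition, for `r = 4` and
`r = 6`. -/
def HasTraceBivector (r : ℕ) (A : Module.End K V) (ξ : Module.Dual K V) : Prop :=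
  ∃ B, IsTraceBivector A ξ B ∧ r ≤ Module.finrank K (LinearMap.range B)

theorem HasTraceBivector.mono {r r' : ℕ} (hr : r' ≤ r) {A : Module.End K V}
    {ξ : Module.Dual K V} (h : HasTraceBivector r A ξ) : HasTraceBivector r' A ξ :=
  let ⟨B, hB, hrank⟩ := h
  ⟨B, hB, hr.trans hrank⟩

end TraceBivectors

section Complexification

open Polynomial in
theorem exists_real_eval_ne_zero {p : ℂ[X]} (hp : p ≠ 0) : ∃ t : ℝ, p.eval (t : ℂ) ≠ 0 := by
  by_contra! h
  refine hp (p.eq_zero_of_infinite_isRoot ?_)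
  refine (Set.infinite_range_of_injective Complex.ofReal_injective).mono ?_
  rintro _ ⟨t, rfl⟩
  exact h t

open Polynomial in
theorem exists_det_map_real_ne_zero {n : Type*} [Fintype n] [DecidableEq n] {M : Matrix n n ℂ}
    (hM : M.det ≠ 0) : ∃ ρ : ℂ →ₗ[ℝ] ℝ, (M.map ρ).det ≠ 0 := by
  -- `re + t im` is the value at `t` of a polynomial which is the identity of `ℂ` at `I`.
  let line (z : ℂ) : ℂ[X] := C (z.re : ℂ) + X * C (z.im : ℂ)
  let ρ (t : ℝ) : ℂ →ₗ[ℝ] ℝ := Complex.reLm + t • Complex.imLm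
  have heval (z : ℂ) : (M.map line).det.eval z = (M.map fun w => (line w).eval z).det := by
    rw [← coe_evalRingHom, RingHom.map_det]
    rfl
  have hI : (M.map line).det ≠ 0 := by
    refine fun hzero => hM ?_
    have hline (w : ℂ) : (line w).eval Complex.I = w := by
      simp [line, Complex.re_add_im]
    have hdet := heval Complex.I
    simp only [hline, hzero, eval_zero, Matrix.map_id'] at hdet
    exact hdet.symm
  obtain ⟨t, ht⟩ := exists_real_eval_ne_zero hI
  refine ⟨ρ t, fun hzero => ht ?_⟩
  have hline (w : ℂ) : (line w).eval (t : ℂ) = (ρ t w : ℂ) := by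
    simp [line, ρ, mul_comm (t : ℂ)]
  rw [heval, funext hline]
  refine (Complex.ofRealHom.map_det (M.map (ρ t))).symm.trans ?_
  rw [hzero, map_zero]

variable {V : Type*} [AddCommGroup V] [Module ℝ V]

theorem baseChange_comp_baseChange (θ : Module.Dual ℝ V) (A : Module.End ℝ V) :
    θ.baseChange ℂ ∘ₗ A.baseChange ℂ = Module.Dual.baseChange ℂ (θ ∘ₗ A) := by
  ext
  simp

theorem coord_baseChange {ι : Type*} (f : Module.Basis ι ℝ V) (i : ι) :
    (f.baseChange ℂ).coord i = Module.Dual.baseChange ℂ (f.coord i) := by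
  ext
  simp

theorem dualBasis_baseChange {ι : Type*} [Finite ι] [DecidableEq ι] (f : Module.Basis ι ℝ V)
    (i : ι) : (f.baseChange ℂ).dualBasis i = Module.Dual.baseChange ℂ (f.dualBasis i) := by
  rw [Module.Basis.coe_dualBasis, Module.Basis.coe_dualBasis, coord_baseChange]

theorem ker_baseChange {ξ : Module.Dual ℝ V} :
    LinearMap.ker (ξ.baseChange ℂ) = (LinearMap.ker ξ).baseChange ℂ := by
  have hinj := (TensorProduct.AlgebraTensorModule.rid ℝ ℂ ℂ).injective
  refine (LinearMap.ker_comp_of_ker_eq_bot _ (LinearMap.ker_eq_bot.2 hinj)).trans ?_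
  exact Module.Flat.ker_lTensor_eq ℂ ℂ ξ

theorem bilinForm_ext_baseChange [Module.Finite ℝ V]
    {B B' : LinearMap.BilinForm ℂ (Module.Dual ℂ (ℂ ⊗[ℝ] V))}
    (h : ∀ α β : Module.Dual ℝ V,
      B (α.baseChange ℂ) (β.baseChange ℂ) = B' (α.baseChange ℂ) (β.baseChange ℂ)) : B = B' := by
  let f := Module.finBasis ℝ V
  refine (f.baseChange ℂ).dualBasis.ext fun i => (f.baseChange ℂ).dualBasis.ext fun j => ?_
  rw [dualBasis_baseChange, dualBasis_baseChange, h]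

theorem exists_bilinForm_baseChange [Module.Finite ℝ V]
    (B : LinearMap.BilinForm ℝ (Module.Dual ℝ V)) :
    ∃ B' : LinearMap.BilinForm ℂ (Module.Dual ℂ (ℂ ⊗[ℝ] V)),
      ∀ α β : Module.Dual ℝ V, B' (α.baseChange ℂ) (β.baseChange ℂ) = (B α β : ℂ) := by
  let f := Module.finBasis ℝ V
  refine ⟨Matrix.toBilin (f.baseChange ℂ).dualBasis
    ((LinearMap.BilinForm.toMatrix f.dualBasis B).map Complex.ofReal), fun α β => ?_⟩
  conv_rhs => rw [← Matrix.toBilin_toMatrix f.dualBasis B, Matrix.toBilin_apply]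
  rw [Matrix.toBilin_apply]
  simp [Module.Basis.dualBasis_repr]

theorem le_finrank_range_of_baseChange [Module.Finite ℝ V] {r : ℕ}
    {B : LinearMap.BilinForm ℝ (Module.Dual ℝ V)}
    {B' : LinearMap.BilinForm ℂ (Module.Dual ℂ (ℂ ⊗[ℝ] V))}
    (h : ∀ α β : Module.Dual ℝ V, B' (α.baseChange ℂ) (β.baseChange ℂ) = (B α β : ℂ))
    (hr : r ≤ Module.finrank ℝ (LinearMap.range B)) :
    r ≤ Module.finrank ℂ (LinearMap.range B') := by
  obtain ⟨α, β, hminor⟩ := le_finrank_range_iff_exists_minor.1 hr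
  refine le_finrank_range_iff_exists_minor.2
    ⟨fun i => (α i).baseChange ℂ, fun i => (β i).baseChange ℂ, ?_⟩
  rw [wedgeCovectors_apply] at hminor ⊢
  simp only [Function.comp_apply, h]
  rw [← Complex.ofReal_ne_zero, ← Complex.ofRealHom_eq_coe, RingHom.map_det] at hminor
  exact hminor

theorem IsTraceBivector.of_baseChange_eq [Module.Finite ℝ V] {A : Module.End ℝ V}
    {ξ : Module.Dual ℝ V} {B : LinearMap.BilinForm ℝ (Module.Dual ℝ V)}
    {B' : LinearMap.BilinForm ℂ (Module.Dual ℂ (ℂ ⊗[ℝ] V))} (hB : IsTraceBivector A ξ B)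
    (h : ∀ α β : Module.Dual ℝ V, B' (α.baseChange ℂ) (β.baseChange ℂ) = (B α β : ℂ)) :
    IsTraceBivector (A.baseChange ℂ) (ξ.baseChange ℂ) B' where
  alt := by
    refine LinearMap.isAlt_iff_eq_neg_flip.2 (bilinForm_ext_baseChange fun α β => ?_)
    rw [LinearMap.neg_apply, LinearMap.neg_apply, LinearMap.flip_apply, h, h,
      ← LinearMap.IsAlt.neg hB.alt, Complex.ofReal_neg]
  left := by
    let f := Module.finBasis ℝ V
    refine (f.baseChange ℂ).dualBasis.ext fun j => ?_
    rw [dualBasis_baseChange, h, hB.left]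
    simp
  trace := by
    refine LinearMap.congr_fun₂ (f := B' ∘ₗ (A.baseChange ℂ).dualMap +
      B'.compl₂ (A.baseChange ℂ).dualMap) (g := LinearMap.trace ℂ _ (A.baseChange ℂ) • B')
      (bilinForm_ext_baseChange fun α β => ?_)
    simp only [LinearMap.add_apply, LinearMap.comp_apply, LinearMap.compl₂_apply,
      LinearMap.smul_apply, LinearMap.dualMap_apply', baseChange_comp_baseChange, h,
      LinearMap.trace_baseChange, ← Complex.ofReal_add, hB.trace]
    simp

/-- The real bilinear form obtained by restriction to real covectors and applying `ρ`. -/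
def realForm (ρ : ℂ →ₗ[ℝ] ℝ) (B : LinearMap.BilinForm ℂ (Module.Dual ℂ (ℂ ⊗[ℝ] V))) :
    LinearMap.BilinForm ℝ (Module.Dual ℝ V) :=
  LinearMap.mk₂ ℝ (fun α β => ρ (B (α.baseChange ℂ) (β.baseChange ℂ)))
    (fun _ _ _ => by simp) (fun _ _ _ => by rw [← map_smul ρ]; simp)
    (fun _ _ _ => by simp) (fun _ _ _ => by rw [← map_smul ρ]; simp)

theorem realForm_apply (ρ : ℂ →ₗ[ℝ] ℝ)
    (B : LinearMap.BilinForm ℂ (Module.Dual ℂ (ℂ ⊗[ℝ] V))) (α β : Module.Dual ℝ V) :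
    realForm ρ B α β = ρ (B (α.baseChange ℂ) (β.baseChange ℂ)) := rfl

theorem IsTraceBivector.realForm [Module.Finite ℝ V] {A : Module.End ℝ V} {ξ : Module.Dual ℝ V}
    {B : LinearMap.BilinForm ℂ (Module.Dual ℂ (ℂ ⊗[ℝ] V))}
    (h : IsTraceBivector (A.baseChange ℂ) (ξ.baseChange ℂ) B) (ρ : ℂ →ₗ[ℝ] ℝ) :
    IsTraceBivector A ξ (realForm ρ B) where
  alt α := by rw [realForm_apply, h.alt, map_zero]
  left := by
    ext β
    rw [realForm_apply, h.left, LinearMap.zero_apply, map_zero, LinearMap.zero_apply]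
  trace α β := by
    simp only [realForm_apply]
    rw [← map_add, ← baseChange_comp_baseChange, ← baseChange_comp_baseChange, h.trace,
      LinearMap.trace_baseChange, Complex.coe_algebraMap, ← Complex.real_smul, map_smul,
      smul_eq_mul]

theorem exists_le_finrank_range_realForm [Module.Finite ℝ V] {r : ℕ}
    {B : LinearMap.BilinForm ℂ (Module.Dual ℂ (ℂ ⊗[ℝ] V))}
    (hr : r ≤ Module.finrank ℂ (LinearMap.range B)) :
    ∃ ρ : ℂ →ₗ[ℝ] ℝ, r ≤ Module.finrank ℝ (LinearMap.range (realForm ρ B)) := by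
  let f := Module.finBasis ℝ V
  obtain ⟨I, J, hminor⟩ := exists_basis_minor_ne_zero (f.baseChange ℂ).dualBasis
    (f.baseChange ℂ).dualBasis hr
  rw [wedgeCovectors_apply] at hminor
  obtain ⟨ρ, hρ⟩ := exists_det_map_real_ne_zero hminor
  refine ⟨ρ, le_finrank_range_iff_exists_minor.2 ⟨f.dualBasis ∘ I, f.dualBasis ∘ J, ?_⟩⟩
  convert hρ using 1
  refine congrArg Matrix.det (Matrix.ext fun i j => ?_)
  change realForm ρ B (f.dualBasis (I j)) (f.dualBasis (J i)) =
    ρ (B ((f.baseChange ℂ).dualBasis (I j)) ((f.baseChange ℂ).dualBasis (J i)))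
  rw [realForm_apply, dualBasis_baseChange, dualBasis_baseChange]

theorem hasTraceBivector_baseChange_iff [Module.Finite ℝ V] {r : ℕ} {A : Module.End ℝ V}
    {ξ : Module.Dual ℝ V} :
    HasTraceBivector r (A.baseChange ℂ) (ξ.baseChange ℂ) ↔ HasTraceBivector r A ξ := by
  constructor
  · rintro ⟨B, hB, hr⟩
    obtain ⟨ρ, hρ⟩ := exists_le_finrank_range_realForm hr
    exact ⟨realForm ρ B, hB.realForm ρ, hρ⟩
  · rintro ⟨B, hB, hr⟩
    obtain ⟨B', hB'⟩ := exists_bilinForm_baseChange B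
    exact ⟨B', hB.of_baseChange_eq hB', le_finrank_range_of_baseChange hB' hr⟩

end Complexification

section Symplectic

variable {K W : Type*} [Field K] [AddCommGroup W] [Module K W] {B : LinearMap.BilinForm K W} {m : ℕ}

/-- The pairs `(a i, b i)` are hyperbolic and mutually orthogonal with respect to the alternating
form `B`, i.e. they form a symplectic basis of their span. -/
structure IsSymplecticFamily (B : LinearMap.BilinForm K W) (a b : Fin m → W) : Prop where
  left_left : ∀ i j, B (a i) (a j) = 0
  left_right : ∀ i j, B (a i) (b j) = if i = j then 1 else 0
  right_right : ∀ i j, B (b i) (b j) = 0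

variable {a b : Fin m → W}

theorem IsSymplecticFamily.right_left (hB : B.IsAlt) (h : IsSymplecticFamily B a b) (i j : Fin m) :
    B (b i) (a j) = if i = j then -1 else 0 := by
  rw [← LinearMap.IsAlt.neg hB, h.left_right]
  simp [eq_comm, apply_ite]

theorem IsSymplecticFamily.cons (hB : B.IsAlt) (h : IsSymplecticFamily B a b) {u v : W}
    (hu : ∀ i, B u (a i) = 0 ∧ B u (b i) = 0) (hv : ∀ i, B v (a i) = 0 ∧ B v (b i) = 0)
    (huv : B u v = 1) :
    IsSymplecticFamily B (Fin.cons u a : Fin (m + 1) → W) (Fin.cons v b : Fin (m + 1) → W) := by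
  have hav (i : Fin m) : B (a i) v = 0 := by rw [← LinearMap.IsAlt.neg hB, (hv i).1, neg_zero]
  have hau (i : Fin m) : B (a i) u = 0 := by rw [← LinearMap.IsAlt.neg hB, (hu i).1, neg_zero]
  have hbv (i : Fin m) : B (b i) v = 0 := by rw [← LinearMap.IsAlt.neg hB, (hv i).2, neg_zero]
  constructor <;> refine Fin.cases (Fin.cases ?_ fun j => ?_) fun i => Fin.cases ?_ fun j => ?_ <;>
    simp [hB.self_eq_zero, h.left_left, h.left_right, h.right_right, hu, hv, huv, hau, hav, hbv,
      Fin.succ_ne_zero, (Fin.succ_ne_zero _).symm]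

/-- The projection to the orthogonal complement of the span of the family. -/
def symplecticProj (B : LinearMap.BilinForm K W) (a b : Fin m → W) (w : W) : W :=
  w - ∑ i, (B w (b i) • a i - B w (a i) • b i)

theorem IsSymplecticFamily.apply_symplecticProj (hB : B.IsAlt) (h : IsSymplecticFamily B a b)
    (w : W) (i : Fin m) :
    B (symplecticProj B a b w) (a i) = 0 ∧ B (symplecticProj B a b w) (b i) = 0 := by
  simp [symplecticProj, h.left_left, h.left_right, h.right_right, h.right_left hB]

theorem apply_symplecticProj_of_orthogonal {u : W}
    (hu : ∀ i, B u (a i) = 0 ∧ B u (b i) = 0) (w : W) : B u (symplecticProj B a b w) = B u w := by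
  simp [symplecticProj, hu]

theorem exists_apply_symplecticProj_ne_zero (B : LinearMap.BilinForm K W) (a b : Fin m → W)
    (hr : 2 * m < Module.finrank K (LinearMap.range B)) :
    ∃ w, B (symplecticProj B a b w) ≠ 0 := by
  by_contra! hzero
  refine hr.not_ge ?_
  have hrange : LinearMap.range B ≤ Submodule.span K (Set.range (Sum.elim (B ∘ a) (B ∘ b))) := by
    rintro _ ⟨w, rfl⟩
    rw [sub_eq_zero.1 ((map_sub B _ _).symm.trans (hzero w)), map_sum]
    refine Submodule.sum_mem _ fun i _ => ?_
    rw [map_sub, map_smul, map_smul]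
    exact sub_mem (Submodule.smul_mem _ _ (Submodule.subset_span ⟨Sum.inl i, rfl⟩))
      (Submodule.smul_mem _ _ (Submodule.subset_span ⟨Sum.inr i, rfl⟩))
  have := FiniteDimensional.span_of_finite K (Set.finite_range (Sum.elim (B ∘ a) (B ∘ b)))
  refine (Submodule.finrank_mono hrange).trans ((finrank_range_le_card _).trans ?_)
  simp [two_mul]

theorem exists_isSymplecticFamily (hB : B.IsAlt)
    (hr : 2 * m ≤ Module.finrank K (LinearMap.range B)) :
    ∃ a b : Fin m → W, IsSymplecticFamily B a b := by
  induction m with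
  | zero => exact ⟨Fin.elim0, Fin.elim0, by constructor <;> exact fun i => i.elim0⟩
  | succ m ih =>
    obtain ⟨a, b, h⟩ := ih (by omega)
    obtain ⟨w, hw⟩ := exists_apply_symplecticProj_ne_zero B a b (by omega)
    obtain ⟨w', hw'⟩ := DFunLike.ne_iff.1 hw
    have hu := h.apply_symplecticProj hB w
    have hv := h.apply_symplecticProj hB w'
    set u := symplecticProj B a b w
    set v := symplecticProj B a b w' with hv_def
    have huv : B u v ≠ 0 := by rwa [hv_def, apply_symplecticProj_of_orthogonal hu]
    refine ⟨_, _, h.cons hB hu (v := (B u v)⁻¹ • v) (fun i => by simp [hv i]) ?_⟩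
    rw [map_smul, smul_eq_mul, inv_mul_cancel₀ huv]

theorem IsSymplecticFamily.linearIndependent_sumElim (hB : B.IsAlt)
    (h : IsSymplecticFamily B a b) {κ : Type*} [Finite κ] {w : κ → W}
    (hw : LinearIndependent K w) (horth : ∀ k i, B (w k) (a i) = 0 ∧ B (w k) (b i) = 0) :
    LinearIndependent K (Sum.elim (Sum.elim a b) w) := by
  have := Fintype.ofFinite κ
  rw [Fintype.linearIndependent_iff] at hw ⊢
  intro g hg
  simp only [Fintype.sum_sum_type, Sum.elim_inl, Sum.elim_inr] at hg
  have ha (i : Fin m) : g (Sum.inl (Sum.inl i)) = 0 := by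
    simpa [h.left_right, h.right_right, horth] using congrArg (fun x => B x (b i)) hg
  have hb (i : Fin m) : g (Sum.inl (Sum.inr i)) = 0 := by
    simpa [h.left_left, h.right_left hB, horth] using congrArg (fun x => B x (a i)) hg
  simp only [ha, hb, zero_smul, Finset.sum_const_zero, zero_add] at hg
  rintro ((i | i) | k)
  exacts [ha i, hb i, hw _ hg k]

theorem finrank_le_finrank_orthogonal_add [FiniteDimensional K W] {κ : Type*} [Fintype κ]
    (B : LinearMap.BilinForm K W) (u : κ → W) :
    Module.finrank K W ≤
      Module.finrank K (LinearMap.ker (LinearMap.pi (B.flip ∘ u))) + Fintype.card κ := by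
  rw [← LinearMap.finrank_range_add_finrank_ker (LinearMap.pi (B.flip ∘ u)), add_comm]
  have hrange := Submodule.finrank_le (LinearMap.range (LinearMap.pi (B.flip ∘ u)))
  rw [Module.finrank_fintype_fun_eq_card] at hrange
  omega

theorem exists_linearIndependent_extension {M : Type*} [AddCommGroup M] [Module K M] {x : M}
    (hx : x ≠ 0) (h : 3 ≤ Module.finrank K M) : ∃ y z : M, LinearIndependent K ![y, z, x] := by
  have h1 : LinearIndependent K ![x] := LinearIndependent.of_subsingleton 0 hx
  obtain ⟨z, h2⟩ := exists_linearIndependent_cons_of_lt_finrank h1 (by omega)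
  obtain ⟨y, h3⟩ := exists_linearIndependent_cons_of_lt_finrank h2 (by omega)
  exact ⟨y, z, h3⟩

theorem IsSymplecticFamily.exists_basis (hB : B.IsAlt) {a b : Fin 2 → W}
    (h : IsSymplecticFamily B a b) (hW : Module.finrank K W = 7) {ξ : W} (hξ : ξ ≠ 0)
    (hBξ : B ξ = 0) :
    ∃ (d : Module.Basis (Fin 7) K W) (y z : W), ⇑d = ![a 0, b 0, a 1, b 1, y, z, ξ] ∧
      (∀ i, B y (a i) = 0 ∧ B y (b i) = 0) ∧ ∀ i, B z (a i) = 0 ∧ B z (b i) = 0 := by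
  have : FiniteDimensional K W := Module.finite_of_finrank_pos (by omega)
  have hdim := finrank_le_finrank_orthogonal_add B (Sum.elim a b)
  set N := LinearMap.ker (LinearMap.pi (B.flip ∘ Sum.elim a b)) with hN
  have hmem {x : W} : x ∈ N ↔ ∀ i, B x (a i) = 0 ∧ B x (b i) = 0 := by
    simp [hN, funext_iff, Sum.forall, forall_and]
  have hξN : ξ ∈ N := hmem.2 fun i => by simp [hBξ]
  obtain ⟨y, z, hyz⟩ := exists_linearIndependent_extension (x := (⟨ξ, hξN⟩ : N))
    (fun hzero => hξ (congrArg Subtype.val hzero)) (by simp [hW] at hdim; omega)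
  have hli := h.linearIndependent_sumElim hB
    (hyz.map' N.subtype (Submodule.ker_subtype N)) fun k => hmem.1 (Subtype.prop _)
  let σ : Fin 7 → (Fin 2 ⊕ Fin 2) ⊕ Fin 3 :=
    ![.inl (.inl 0), .inl (.inr 0), .inl (.inl 1), .inl (.inr 1), .inr 0, .inr 1, .inr 2]
  refine ⟨basisOfLinearIndependentOfCardEqFinrank (hli.comp σ (by decide)) (by simp [hW]), y, z,
    ?_, hmem.1 y.2, hmem.1 z.2⟩
  rw [coe_basisOfLinearIndependentOfCardEqFinrank]
  ext i
  fin_cases i <;> rfl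

end Symplectic

section NormalForm

variable {K V : Type*} [Field K] [AddCommGroup V] [Module K V]

theorem exists_dualBasis_eq {ι : Type*} [Finite ι] [DecidableEq ι] [FiniteDimensional K V]
    (b : Module.Basis ι K (Module.Dual K V)) : ∃ f : Module.Basis ι K V, f.dualBasis = b := by
  let f := b.dualBasis.map (Module.evalEquiv K V).symm
  have hf (θ : Module.Dual K V) (i : ι) : θ (f i) = b.repr θ i := by
    have h : Module.evalEquiv K V (f i) = b.dualBasis i := by simp [f]
    have h2 := DFunLike.congr_fun h θ
    rwa [b.dualBasis_apply] at h2
  refine ⟨f, Module.Basis.eq_of_apply_eq fun i => f.ext fun j => ?_⟩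
  rw [hf (b i), f.dualBasis_apply_self, b.repr_self, Finsupp.single_apply]
  simp only [eq_comm]

/-- The bivector `f₀ ∧ f₁ + f₂ ∧ f₃ + c f₄ ∧ f₅`. -/
def normalBivec (c : K) (f : Fin 7 → V) : LinearMap.BilinForm K (Module.Dual K V) :=
  let bivec (u v : V) : LinearMap.BilinForm K (Module.Dual K V) :=
    LinearMap.BilinForm.linMulLin (Module.Dual.eval K V u) (Module.Dual.eval K V v) -
      LinearMap.BilinForm.linMulLin (Module.Dual.eval K V v) (Module.Dual.eval K V u)
  bivec (f 0) (f 1) + bivec (f 2) (f 3) + c • bivec (f 4) (f 5)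

theorem normalBivec_apply (c : K) (f : Fin 7 → V) (α β : Module.Dual K V) :
    normalBivec c f α β = (α (f 0) * β (f 1) - α (f 1) * β (f 0)) +
      (α (f 2) * β (f 3) - α (f 3) * β (f 2)) + c * (α (f 4) * β (f 5) - α (f 5) * β (f 4)) := rfl

theorem exists_eq_normalBivec (hV : Module.finrank K V = 7)
    {B : LinearMap.BilinForm K (Module.Dual K V)} (hB : B.IsAlt) {ξ : Module.Dual K V}
    (hξ : ξ ≠ 0) (hBξ : B ξ = 0) (hr : 4 ≤ Module.finrank K (LinearMap.range B)) :
    ∃ (c : K) (f : Module.Basis (Fin 7) K V), ξ = f.coord 6 ∧ B = normalBivec c f := by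
  have : FiniteDimensional K V := Module.finite_of_finrank_pos (by omega)
  obtain ⟨a, b, h⟩ := exists_isSymplecticFamily (m := 2) hB hr
  obtain ⟨d, y, z, hd, hy, hz⟩ := h.exists_basis hB (Subspace.dual_finrank_eq.trans hV) hξ hBξ
  obtain ⟨f, rfl⟩ := exists_dualBasis_eq d
  rw [f.coe_dualBasis] at hd
  refine ⟨B y z, f, by rw [hd]; rfl, f.dualBasis.ext fun i => f.dualBasis.ext fun j => ?_⟩
  have hswap (α β) : B α β = -B β α := (LinearMap.IsAlt.neg hB β α).symm
  rw [normalBivec_apply]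
  simp only [f.dualBasis_apply_self]
  rw [f.coe_dualBasis, hd]
  fin_cases i <;> fin_cases j <;>
    simp [h.left_left, h.left_right, h.right_left hB, h.right_right, hB.self_eq_zero, hy, hz, hBξ,
      hswap (a _) y, hswap (a _) z, hswap (b _) y, hswap (b _) z, hswap z y, hswap _ ξ]

theorem exists_normalBivec_eq_normalBivec_one {c : K} (hc : c ≠ 0)
    (f : Module.Basis (Fin 7) K V) :
    ∃ f' : Module.Basis (Fin 7) K V, f.coord 6 = f'.coord 6 ∧
      normalBivec c f = normalBivec 1 f' := by
  let w : Fin 7 → Kˣ := ![1, 1, 1, 1, Units.mk0 c hc, 1, 1]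
  refine ⟨f.unitsSMul w, ?_, ?_⟩
  · ext v
    simp [w]
  · ext α β
    simp only [normalBivec_apply, w, Module.Basis.unitsSMul_apply, Matrix.cons_val_zero,
      Matrix.cons_val_one, Matrix.cons_val, one_smul, Units.smul_def, Units.val_mk0, map_smul,
      smul_eq_mul]
    ring

theorem finrank_range_normalBivec_zero_le (f : Fin 7 → V) :
    Module.finrank K (LinearMap.range (normalBivec (0 : K) f)) ≤ 4 := by
  let ev (i : Fin 4) : Module.Dual K (Module.Dual K V) :=
    Module.Dual.eval K V (f (i.castLE (by decide)))
  have hspan (c : K) (i : Fin 4) : c • ev i ∈ Submodule.span K (Set.range ev) :=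
    Submodule.smul_mem _ c (Submodule.subset_span ⟨i, rfl⟩)
  have hrange : LinearMap.range (normalBivec (0 : K) f) ≤ Submodule.span K (Set.range ev) := by
    rintro _ ⟨α, rfl⟩
    have hα : normalBivec (0 : K) f α =
        (α (f 0) • ev 1 - α (f 1) • ev 0) + (α (f 2) • ev 3 - α (f 3) • ev 2) := by
      ext β
      rw [normalBivec_apply, zero_mul, add_zero]
      rfl
    rw [hα]
    exact add_mem (sub_mem (hspan _ 1) (hspan _ 0)) (sub_mem (hspan _ 3) (hspan _ 2))
  have := FiniteDimensional.span_of_finite K (Set.finite_range ev)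
  simpa using (Submodule.finrank_mono hrange).trans (finrank_range_le_card ev)

theorem exists_eq_normalBivec_one (hV : Module.finrank K V = 7)
    {B : LinearMap.BilinForm K (Module.Dual K V)} (hB : B.IsAlt) {ξ : Module.Dual K V}
    (hξ : ξ ≠ 0) (hBξ : B ξ = 0) (hr : 6 ≤ Module.finrank K (LinearMap.range B)) :
    ∃ f : Module.Basis (Fin 7) K V, ξ = f.coord 6 ∧ B = normalBivec 1 f := by
  obtain ⟨c, f, rfl, rfl⟩ := exists_eq_normalBivec hV hB hξ hBξ (by omega)
  have hc : c ≠ 0 := by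
    rintro rfl
    have := finrank_range_normalBivec_zero_le (K := K) f
    omega
  exact exists_normalBivec_eq_normalBivec_one hc f

end NormalForm

section Orbits

variable {K V : Type*} [Field K] [AddCommGroup V] [Module K V]

theorem four_le_finrank_range_of_pfaffian4_ne_zero {W : Type*} [AddCommGroup W] [Module K W]
    [FiniteDimensional K W] {B : LinearMap.BilinForm K W} (hB : B.IsAlt) {α β γ δ : W}
    (h : pfaffian4 B α β γ δ ≠ 0) : 4 ≤ Module.finrank K (LinearMap.range B) := by
  refine le_finrank_range_iff_exists_minor.2 ⟨![α, β, γ, δ], ![α, β, γ, δ], ?_⟩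
  have hdet : wedgeCovectors (B ∘ ![α, β, γ, δ]) ![α, β, γ, δ] = pfaffian4 B α β γ δ ^ 2 := by
    have hswap (x y : W) : B x y = -B y x := (LinearMap.IsAlt.neg hB y x).symm
    rw [wedgeCovectors_apply, pfaffian4]
    simp [Matrix.det_succ_row_zero, Fin.sum_univ_succ, Fin.succAbove, hB.self_eq_zero, hswap β α,
      hswap γ α, hswap γ β, hswap δ α, hswap δ β, hswap δ γ]
    ring
  rw [hdet]
  exact pow_ne_zero 2 h

theorem six_le_finrank_range_phiBivec {s : ℤˣ} {e : Module.Basis (Fin 7) K V}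
    {ξ : Module.Dual K V} (hξ : ξ (sharp (metricSign s) e ξ) ≠ 0) :
    6 ≤ Module.finrank K (LinearMap.range (phiBivec s e ξ)) := by
  have : FiniteDimensional K V := Module.Finite.of_basis e
  have hker : LinearMap.ker (phiBivec s e ξ) ≤ Submodule.span K {ξ} := fun α hα => by
    obtain ⟨c, rfl⟩ := phiBivec_radical hξ hα
    exact Submodule.smul_mem _ c (Submodule.mem_span_singleton_self ξ)
  have hnullity : Module.finrank K (LinearMap.ker (phiBivec s e ξ)) ≤ 1 := by
    simpa using (Submodule.finrank_mono hker).trans (finrank_span_le_card {ξ})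
  have hrank := LinearMap.finrank_range_add_finrank_ker (phiBivec s e ξ)
  rw [Subspace.dual_finrank_eq, Module.finrank_eq_card_basis e, Fintype.card_fin] at hrank
  omega

theorem exists_phiBivec_eq_normalBivec_one (s : ℤˣ) (f : Module.Basis (Fin 7) K V) :
    ∃ e : Module.Basis (Fin 7) K V, phiBivec s e (f.coord 6) = normalBivec 1 f ∧
      f.coord 6 (sharp (metricSign s) e (f.coord 6)) ≠ 0 := by
  rcases Int.units_eq_one_or s with rfl | rfl
  · refine ⟨f, LinearMap.ext₂ fun α β => ?_, ?_⟩
    · simp [phiBivec_apply_eq_sum, normalBivec_apply, Matrix.det_fin_three]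
    · simp [sharp_coord, metricSign]
  · let e := f.reindex (Equiv.swap 0 1 * Equiv.swap 2 3)
    have he : ⇑e = ![f 1, f 0, f 3, f 2, f 4, f 5, f 6] := by
      ext i
      rw [Module.Basis.reindex_apply]
      fin_cases i <;> rfl
    refine ⟨e, LinearMap.ext₂ fun α β => ?_, ?_⟩
    · simp [phiBivec_apply_eq_sum, normalBivec_apply, Matrix.det_fin_three, he]
    · simp [sharp, Fin.sum_univ_seven, metricSign, he]

/-- Here `f.coord 6` is a null covector for the metric induced by `phi (-1) e`. -/
theorem exists_phiBivec_neg_one_eq_normalBivec_zero [CharZero K] (f : Module.Basis (Fin 7) K V) :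
    ∃ e : Module.Basis (Fin 7) K V, phiBivec (-1) e (f.coord 6) = normalBivec 0 f := by
  have hli : LinearIndependent K ![f 0 - (2⁻¹ : K) • f 6, -f 1, (2⁻¹ : K) • f 4 - f 2,
      (2⁻¹ : K) • (f 3 + f 5), (2⁻¹ : K) • (f 3 - f 5), -f 2 - (2⁻¹ : K) • f 4,
      f 0 + (2⁻¹ : K) • f 6] := by
    refine Fintype.linearIndependent_iff.2 fun g hg i => ?_
    have hcoord (j : Fin 7) := congrArg (f.coord j) hg
    have h0 : g 0 + g 6 = 0 := by simpa [Fin.sum_univ_seven] using hcoord 0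
    have h1 : g 1 = 0 := by simpa [Fin.sum_univ_seven] using hcoord 1
    have h2 : -g 2 + -g 5 = 0 := by simpa [Fin.sum_univ_seven] using hcoord 2
    have h3 : g 3 * 2⁻¹ + g 4 * 2⁻¹ = 0 := by simpa [Fin.sum_univ_seven] using hcoord 3
    have h4 : g 2 * 2⁻¹ + -(g 5 * 2⁻¹) = 0 := by simpa [Fin.sum_univ_seven] using hcoord 4
    have h5 : g 3 * 2⁻¹ + -(g 4 * 2⁻¹) = 0 := by simpa [Fin.sum_univ_seven] using hcoord 5
    have h6 : -(g 0 * 2⁻¹) + g 6 * 2⁻¹ = 0 := by simpa [Fin.sum_univ_seven] using hcoord 6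
    match i with
    | 0 => linear_combination h0 / 2 - h6
    | 1 => exact h1
    | 2 => linear_combination h4 - h2 / 2
    | 3 => linear_combination h3 + h5
    | 4 => linear_combination h3 - h5
    | 5 => linear_combination -h2 / 2 - h4
    | 6 => linear_combination h0 / 2 + h6
  let e := basisOfLinearIndependentOfCardEqFinrank hli (Module.finrank_eq_card_basis f).symm
  have he : ⇑e = _ := coe_basisOfLinearIndependentOfCardEqFinrank _ _
  refine ⟨e, LinearMap.ext₂ fun α β => ?_⟩
  simp [phiBivec_apply_eq_sum, normalBivec_apply, Matrix.det_fin_three, he]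
  ring

theorem exists_phiBivec_eq_of_six_le (hV : Module.finrank K V = 7) (s : ℤˣ)
    {B : LinearMap.BilinForm K (Module.Dual K V)} (hB : B.IsAlt) {ξ : Module.Dual K V}
    (hξ : ξ ≠ 0) (hBξ : B ξ = 0) (hr : 6 ≤ Module.finrank K (LinearMap.range B)) :
    ∃ e : Module.Basis (Fin 7) K V,
      phiBivec s e ξ = B ∧ ξ (sharp (metricSign s) e ξ) ≠ 0 := by
  obtain ⟨f, rfl, rfl⟩ := exists_eq_normalBivec_one hV hB hξ hBξ hr
  exact exists_phiBivec_eq_normalBivec_one s f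

theorem exists_phiBivec_neg_one_eq_of_four_le [CharZero K] (hV : Module.finrank K V = 7)
    {B : LinearMap.BilinForm K (Module.Dual K V)} (hB : B.IsAlt) {ξ : Module.Dual K V}
    (hξ : ξ ≠ 0) (hBξ : B ξ = 0) (hr : 4 ≤ Module.finrank K (LinearMap.range B)) :
    ∃ e : Module.Basis (Fin 7) K V, phiBivec (-1) e ξ = B := by
  obtain ⟨c, f, rfl, rfl⟩ := exists_eq_normalBivec hV hB hξ hBξ hr
  rcases eq_or_ne c 0 with rfl | hc
  · exact exists_phiBivec_neg_one_eq_normalBivec_zero f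
  · obtain ⟨f', hcoord, hbivec⟩ := exists_normalBivec_eq_normalBivec_one hc f
    obtain ⟨e, he, -⟩ := exists_phiBivec_eq_normalBivec_one (-1) f'
    exact ⟨e, by rw [hcoord, hbivec, he]⟩

theorem exists_isTraceBivector_phiBivec_and_ne_zero_iff (hV : Module.finrank K V = 7)
    {A : Module.End K V} {ξ : Module.Dual K V} (hξ : ξ ≠ 0) (s : ℤˣ) :
    (∃ e : Module.Basis (Fin 7) K V, IsTraceBivector A ξ (phiBivec s e ξ) ∧
      ξ (sharp (metricSign s) e ξ) ≠ 0) ↔ HasTraceBivector 6 A ξ := by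
  constructor
  · rintro ⟨e, he, hnorm⟩
    exact ⟨_, he, six_le_finrank_range_phiBivec hnorm⟩
  · rintro ⟨B, hB, hr⟩
    obtain ⟨e, rfl, hnorm⟩ := exists_phiBivec_eq_of_six_le hV s hB.alt hξ hB.left hr
    exact ⟨e, hB, hnorm⟩

theorem exists_isTraceBivector_phiBivec_neg_one_iff [CharZero K] (hV : Module.finrank K V = 7)
    {A : Module.End K V} {ξ : Module.Dual K V} (hξ : ξ ≠ 0) :
    (∃ e : Module.Basis (Fin 7) K V, IsTraceBivector A ξ (phiBivec (-1) e ξ)) ↔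
      HasTraceBivector 4 A ξ := by
  constructor
  · rintro ⟨e, he⟩
    have : FiniteDimensional K V := Module.Finite.of_basis e
    obtain ⟨α, β, γ, δ, hpf⟩ := exists_pfaffian4_phiBivec_ne_zero (-1) e hξ
    exact ⟨_, he, four_le_finrank_range_of_pfaffian4_ne_zero he.alt hpf⟩
  · rintro ⟨B, hB, hr⟩
    obtain ⟨e, rfl⟩ := exists_phiBivec_neg_one_eq_of_four_le hV hB.alt hξ hB.left hr
    exact ⟨e, hB⟩

end Orbits

section ComplexStructures

variable {K V : Type*} [Field K] [AddCommGroup V] [Module K V]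

theorem coordForm_unitsSMul {n k : ℕ} (e : Module.Basis (Fin n) K V) (w : Fin n → Kˣ)
    (I : Fin k → Fin n) :
    coordForm (e.unitsSMul w) I = (∏ a, ((w (I a))⁻¹ : Kˣ) : K) • coordForm e I := by
  ext v
  rw [AlternatingMap.smul_apply, coordForm, coordForm, wedgeCovectors_apply, wedgeCovectors_apply,
    smul_eq_mul, ← Matrix.det_mul_row]
  congr 1
  ext i j
  simp [Units.smul_def]

theorem exists_phi_neg_eq_phi {i : K} (hi : i * i = -1) (s : ℤˣ) (e : Module.Basis (Fin 7) K V) :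
    ∃ f : Module.Basis (Fin 7) K V, coordForm f id = coordForm e id ∧ phi (-s) f = phi s e := by
  let u : Kˣ := ⟨i, -i, by simp [hi], by simp [hi]⟩
  refine ⟨e.unitsSMul ![u, u, u, u, -1, -1, 1], ?_, ?_⟩
  · have hdet : (∏ a, ((![u, u, u, u, -1, -1, 1] (id a))⁻¹ : Kˣ) : K) = 1 := by
      simp [Fin.prod_univ_seven, u, hi]
    rw [coordForm_unitsSMul, hdet, one_smul]
  · simp [phi, phiTerms, FormTerms.toForm_cons, FormTerms.toForm_nil, coordForm_unitsSMul,
      Fin.prod_univ_succ, u, hi]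
    module

theorem isG2ComplexStructure_iff {W : Type*} [AddCommGroup W] [Module ℂ W]
    {φ : W [⋀^Fin 3]→ₗ[ℂ] ℂ} {vol : W [⋀^Fin 7]→ₗ[ℂ] ℂ} :
    IsG2ComplexStructure φ vol ↔
      ∃ e : Module.Basis (Fin 7) ℂ W, φ = phi (-1) e ∧ vol = coordForm e id := by
  constructor
  · rintro ⟨e, rfl, rfl⟩
    obtain ⟨f, hvol, hform⟩ := exists_phi_neg_eq_phi Complex.I_mul_I 1 e
    exact ⟨f, by rw [hform, phi_one], hvol.symm⟩
  · rintro ⟨e, rfl, rfl⟩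
    obtain ⟨f, hvol, hform⟩ := exists_phi_neg_eq_phi Complex.I_mul_I (-1) e
    exact ⟨f, hvol.symm, by rw [← hform, neg_neg, phi_one]⟩

end ComplexStructures

section AdaptedBases

variable {K V : Type*} [Field K] [AddCommGroup V] [Module K V]

/-- `e` is a basis adapted to the three-form `φ`, which has sign `s` and induces the metric `g` and
the volume form `vol`. -/
structure IsAdaptedBasis (s : ℤˣ) (φ : V [⋀^Fin 3]→ₗ[K] K) (g : LinearMap.BilinForm K V)
    (vol : V [⋀^Fin 7]→ₗ[K] K) (e : Module.Basis (Fin 7) K V) : Prop where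
  form_eq : φ = phi s e
  metric_eq : g = signedMetric (metricSign s) e
  vol_eq : vol = coordForm e id

theorem isAdaptedBasis_iff_metricRelation [CharZero K] {s : ℤˣ} {φ : V [⋀^Fin 3]→ₗ[K] K}
    {g : LinearMap.BilinForm K V} {vol : V [⋀^Fin 7]→ₗ[K] K} {e : Module.Basis (Fin 7) K V} :
    IsAdaptedBasis s φ g vol e ↔
      (φ = phi s e ∧ vol = coordForm e id) ∧ MetricRelation φ g vol := by
  constructor
  · rintro ⟨rfl, rfl, hvol⟩
    exact ⟨⟨rfl, hvol⟩, metricRelation_phi_iff.2 (by rw [eq_coordForm_id_iff.1 hvol, one_smul])⟩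
  · rintro ⟨⟨rfl, hvol⟩, hg⟩
    rw [metricRelation_phi_iff, eq_coordForm_id_iff.1 hvol, one_smul] at hg
    exact ⟨rfl, hg, hvol⟩

theorem isAdaptedBasis_iff_isInducedMetric {V : Type*} [AddCommGroup V] [Module ℝ V] {s : ℤˣ}
    {φ : V [⋀^Fin 3]→ₗ[ℝ] ℝ} {g : LinearMap.BilinForm ℝ V} {vol : V [⋀^Fin 7]→ₗ[ℝ] ℝ}
    {e : Module.Basis (Fin 7) ℝ V} :
    IsAdaptedBasis s φ g vol e ↔ φ = phi s e ∧ IsInducedMetric φ g vol := by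
  constructor
  · rintro ⟨rfl, hg, hvol⟩
    exact ⟨rfl, isInducedMetric_phi_iff.2 ⟨hg, hvol⟩⟩
  · rintro ⟨rfl, h⟩
    exact ⟨rfl, (isInducedMetric_phi_iff.1 h).1, (isInducedMetric_phi_iff.1 h).2⟩

end AdaptedBases

section CocalibratedStructures

variable {𝔤 : Type*} [LieRing 𝔤]

theorem isCocalibratedG2_iff [LieAlgebra ℝ 𝔤] {φ : 𝔤 [⋀^Fin 3]→ₗ[ℝ] ℝ}
    {g : LinearMap.BilinForm ℝ 𝔤} {vol : 𝔤 [⋀^Fin 7]→ₗ[ℝ] ℝ} :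
    IsCocalibratedG2 φ g vol ↔
      (∃ e, IsAdaptedBasis 1 φ g vol e) ∧ HasClosedHodgeDual g vol φ := by
  simp only [IsCocalibratedG2, IsG2Structure, isAdaptedBasis_iff_isInducedMetric, phi_one,
    exists_and_right, and_assoc]

theorem isCocalibratedG2Star_iff [LieAlgebra ℝ 𝔤] {φ : 𝔤 [⋀^Fin 3]→ₗ[ℝ] ℝ}
    {g : LinearMap.BilinForm ℝ 𝔤} {vol : 𝔤 [⋀^Fin 7]→ₗ[ℝ] ℝ} :
    IsCocalibratedG2Star φ g vol ↔
      (∃ e, IsAdaptedBasis (-1) φ g vol e) ∧ HasClosedHodgeDual g vol φ := by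
  simp only [IsCocalibratedG2Star, IsG2StarStructure, isAdaptedBasis_iff_isInducedMetric,
    phi_neg_one, exists_and_right, and_assoc]

theorem isCocalibratedG2Complex_iff [LieAlgebra ℂ 𝔤] {φ : 𝔤 [⋀^Fin 3]→ₗ[ℂ] ℂ}
    {g : LinearMap.BilinForm ℂ 𝔤} {vol : 𝔤 [⋀^Fin 7]→ₗ[ℂ] ℂ} :
    IsCocalibratedG2Complex φ g vol ↔
      (∃ e, IsAdaptedBasis (-1) φ g vol e) ∧ HasClosedHodgeDual g vol φ := by
  simp only [IsCocalibratedG2Complex, isG2ComplexStructure_iff, isAdaptedBasis_iff_metricRelation,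
    exists_and_right, ← and_assoc]

end CocalibratedStructures

section LieAlgebra

variable {K 𝔤 : Type*} [Field K] [LieRing 𝔤] [LieAlgebra K 𝔤]

theorem IsAlmostAbelianBracket.exists_isAdaptedBasis_and_iff {ξ : Module.Dual K 𝔤}
    {A : Module.End K 𝔤} (h : IsAlmostAbelianBracket ξ A) (s : ℤˣ)
    (P : LinearMap.BilinForm K 𝔤 → Prop) :
    (∃ φ g vol, ((∃ e, IsAdaptedBasis s φ g vol e) ∧ HasClosedHodgeDual g vol φ) ∧ P g) ↔
      ∃ e : Module.Basis (Fin 7) K 𝔤, IsTraceBivector A ξ (phiBivec s e ξ) ∧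
        P (signedMetric (metricSign s) e) := by
  constructor
  · rintro ⟨_, _, _, ⟨⟨e, rfl, rfl, rfl⟩, hclosed⟩, hP⟩
    exact ⟨e, (h.hasClosedHodgeDual_phi_iff s e).1 hclosed, hP⟩
  · rintro ⟨e, he, hP⟩
    exact ⟨_, _, _, ⟨⟨e, rfl, rfl, rfl⟩, (h.hasClosedHodgeDual_phi_iff s e).2 he⟩, hP⟩

end LieAlgebra

section RealLieAlgebra

variable {𝔤 : Type*} [LieRing 𝔤] [LieAlgebra ℝ 𝔤] {ξ : Module.Dual ℝ 𝔤} {A : Module.End ℝ 𝔤}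

theorem apply_sharp_one_ne_zero {V : Type*} [AddCommGroup V] [Module ℝ V]
    (e : Module.Basis (Fin 7) ℝ V) {ξ : Module.Dual ℝ V} (hξ : ξ ≠ 0) :
    ξ (sharp (metricSign 1) e ξ) ≠ 0 := by
  have hsum : ξ (sharp (metricSign 1) e ξ) = ∑ i, ξ (e i) * ξ (e i) := by
    simp [sharp, metricSign]
  rw [hsum]
  intro hzero
  refine hξ (e.ext fun i => ?_)
  rw [Finset.sum_eq_zero_iff_of_nonneg fun i _ => mul_self_nonneg _] at hzero
  exact mul_self_eq_zero.1 (hzero i (Finset.mem_univ i))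

theorem IsAlmostAbelianBracket.admitsCocalibratedG2_iff (h : IsAlmostAbelianBracket ξ A)
    (hdim : Module.finrank ℝ 𝔤 = 7) (hξ : ξ ≠ 0) :
    AdmitsCocalibratedG2 𝔤 ↔ HasTraceBivector 6 A ξ := by
  rw [← exists_isTraceBivector_phiBivec_and_ne_zero_iff hdim hξ 1]
  simpa [AdmitsCocalibratedG2, isCocalibratedG2_iff, apply_sharp_one_ne_zero _ hξ] using
    h.exists_isAdaptedBasis_and_iff 1 fun _ => True

theorem IsAlmostAbelianBracket.admitsCocalibratedG2Star_iff (h : IsAlmostAbelianBracket ξ A)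
    (hdim : Module.finrank ℝ 𝔤 = 7) (hξ : ξ ≠ 0) :
    AdmitsCocalibratedG2Star 𝔤 ↔ HasTraceBivector 4 A ξ := by
  rw [← exists_isTraceBivector_phiBivec_neg_one_iff hdim hξ]
  simpa [AdmitsCocalibratedG2Star, isCocalibratedG2Star_iff] using
    h.exists_isAdaptedBasis_and_iff (-1) fun _ => True

theorem IsAlmostAbelianBracket.admitsCocalibratedG2StarNondeg_ker_iff
    (h : IsAlmostAbelianBracket ξ A) (hdim : Module.finrank ℝ 𝔤 = 7) (hξ : ξ ≠ 0) :
    AdmitsCocalibratedG2StarNondeg 𝔤 (LinearMap.ker ξ) ↔ HasTraceBivector 6 A ξ := by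
  simp only [AdmitsCocalibratedG2StarNondeg, isCocalibratedG2Star_iff,
    h.exists_isAdaptedBasis_and_iff (-1) fun g => (g.restrict (LinearMap.ker ξ)).Nondegenerate,
    signedMetric_restrict_ker_nondegenerate_iff hξ,
    exists_isTraceBivector_phiBivec_and_ne_zero_iff hdim hξ]

end RealLieAlgebra

section ComplexLieAlgebra

variable {𝔤 : Type*} [LieRing 𝔤] [LieAlgebra ℂ 𝔤] {ξ : Module.Dual ℂ 𝔤} {A : Module.End ℂ 𝔤}

theorem IsAlmostAbelianBracket.admitsCocalibratedG2Complex_iff (h : IsAlmostAbelianBracket ξ A)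
    (hdim : Module.finrank ℂ 𝔤 = 7) (hξ : ξ ≠ 0) :
    AdmitsCocalibratedG2Complex 𝔤 ↔ HasTraceBivector 4 A ξ := by
  rw [← exists_isTraceBivector_phiBivec_neg_one_iff hdim hξ]
  simpa [AdmitsCocalibratedG2Complex, isCocalibratedG2Complex_iff] using
    h.exists_isAdaptedBasis_and_iff (-1) fun _ => True

theorem IsAlmostAbelianBracket.admitsCocalibratedG2ComplexNondeg_ker_iff
    (h : IsAlmostAbelianBracket ξ A) (hdim : Module.finrank ℂ 𝔤 = 7) (hξ : ξ ≠ 0) :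
    AdmitsCocalibratedG2ComplexNondeg 𝔤 (LinearMap.ker ξ) ↔ HasTraceBivector 6 A ξ := by
  simp only [AdmitsCocalibratedG2ComplexNondeg, isCocalibratedG2Complex_iff,
    h.exists_isAdaptedBasis_and_iff (-1) fun g => (g.restrict (LinearMap.ker ξ)).Nondegenerate,
    signedMetric_restrict_ker_nondegenerate_iff hξ,
    exists_isTraceBivector_phiBivec_and_ne_zero_iff hdim hξ]

end ComplexLieAlgebra

section AbelianIdeal

theorem exists_isAlmostAbelianBracket_of_abelian_ideal {K 𝔤 : Type*} [Field K] [LieRing 𝔤]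
    [LieAlgebra K 𝔤] [FiniteDimensional K 𝔤] (𝔲 : LieIdeal K 𝔤) [IsLieAbelian 𝔲]
    (hdim : Module.finrank K 𝔲 + 1 = Module.finrank K 𝔤) :
    ∃ (ξ : Module.Dual K 𝔤) (A : Module.End K 𝔤), ξ ≠ 0 ∧ 𝔲.toSubmodule = LinearMap.ker ξ ∧
      IsAlmostAbelianBracket ξ A := by
  change Module.finrank K 𝔲.toSubmodule + 1 = _ at hdim
  obtain ⟨ξ, hξ, hle⟩ := Submodule.exists_le_ker_of_lt_top 𝔲.toSubmodule
    (Submodule.lt_top_of_finrank_lt_finrank (by omega))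
  have hker : 𝔲.toSubmodule = LinearMap.ker ξ := by
    have hfinrank := Module.Dual.finrank_ker_add_one_of_ne_zero hξ
    exact Submodule.eq_of_le_of_finrank_eq hle (by omega)
  have hmem (w : 𝔤) : w ∈ 𝔲 ↔ ξ w = 0 := by
    rw [← LieSubmodule.mem_toSubmodule, hker, LinearMap.mem_ker]
  obtain ⟨x, hx⟩ : ∃ x, ξ x = 1 := LinearMap.surjective hξ 1
  have hproj (w : 𝔤) : w - ξ w • x ∈ 𝔲 := (hmem _).2 (by simp [hx])
  refine ⟨ξ, LieAlgebra.ad K 𝔤 x, hξ, hker, fun v w => ?_, LinearMap.ext fun w => ?_⟩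
  · have hcomm : ⁅v - ξ v • x, w - ξ w • x⁆ = 0 :=
      congrArg Subtype.val (trivial_lie_zero 𝔲 𝔲 ⟨_, hproj v⟩ ⟨_, hproj w⟩)
    simp only [sub_lie, lie_sub, smul_lie, lie_smul, lie_self, smul_zero, sub_zero] at hcomm
    rw [LieAlgebra.ad_apply, LieAlgebra.ad_apply, ← sub_eq_zero, ← hcomm, ← lie_skew v x]
    module
  · have hlie : ⁅x, w - ξ w • x⁆ = ⁅x, w⁆ := by simp
    rw [LinearMap.comp_apply, LieAlgebra.ad_apply, ← hlie, LinearMap.zero_apply, ← hmem]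
    exact lie_mem_right K 𝔤 𝔲 _ _ (hproj w)

theorem IsAlmostAbelianBracket.baseChange {𝔤 : Type*} [LieRing 𝔤] [LieAlgebra ℝ 𝔤]
    {ξ : Module.Dual ℝ 𝔤} {A : Module.End ℝ 𝔤} (h : IsAlmostAbelianBracket ξ A) :
    IsAlmostAbelianBracket (𝔤 := ℂ ⊗[ℝ] 𝔤) (ξ.baseChange ℂ) (A.baseChange ℂ) where
  lie_eq v w := by
    let ξ' : Module.Dual ℂ (ℂ ⊗[ℝ] 𝔤) := ξ.baseChange ℂ
    let A' : Module.End ℂ (ℂ ⊗[ℝ] 𝔤) := A.baseChange ℂ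
    have had : (LieAlgebra.ad ℂ (ℂ ⊗[ℝ] 𝔤) : ℂ ⊗[ℝ] 𝔤 →ₗ[ℂ] Module.End ℂ (ℂ ⊗[ℝ] 𝔤)) =
        ξ'.smulRight A' - (ξ'.smulRight A').flip := by
      ext x y
      have hpure : ⁅(1 : ℂ) ⊗ₜ[ℝ] x, (1 : ℂ) ⊗ₜ[ℝ] y⁆ =
          ξ' (1 ⊗ₜ x) • A' (1 ⊗ₜ y) - ξ' (1 ⊗ₜ y) • A' (1 ⊗ₜ x) := by
        simp [h.lie_eq, ξ', A', TensorProduct.tmul_sub, TensorProduct.smul_tmul']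
      exact hpure
    exact LinearMap.congr_fun₂ had v w
  comp_eq_zero := by rw [baseChange_comp_baseChange, h.comp_eq_zero, map_zero]

theorem baseChange_ne_zero {V : Type*} [AddCommGroup V] [Module ℝ V] {ξ : Module.Dual ℝ V}
    (hξ : ξ ≠ 0) : ξ.baseChange ℂ ≠ 0 := by
  intro hzero
  refine hξ (LinearMap.ext fun v => ?_)
  simpa using LinearMap.congr_fun hzero (1 ⊗ₜ v)

end AbelianIdeal

end CocalibratedG2

end

theorem mainTheorem8 {𝔤 : Type*} [LieRing 𝔤] [LieAlgebra ℝ 𝔤]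
    (hdim : Module.finrank ℝ 𝔤 = 7) (𝔲 : LieIdeal ℝ 𝔤) (habelian : IsLieAbelian 𝔲)
    (hdimu : Module.finrank ℝ 𝔲 = 6) :
    (CocalibratedG2.AdmitsCocalibratedG2 𝔤 → CocalibratedG2.AdmitsCocalibratedG2Star 𝔤) ∧
    (CocalibratedG2.AdmitsCocalibratedG2 𝔤 ↔
      CocalibratedG2.AdmitsCocalibratedG2StarNondeg 𝔤 𝔲.toSubmodule) ∧
    (CocalibratedG2.AdmitsCocalibratedG2Complex (ℂ ⊗[ℝ] 𝔤) ↔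
      CocalibratedG2.AdmitsCocalibratedG2Star 𝔤) ∧
    (CocalibratedG2.AdmitsCocalibratedG2ComplexNondeg (ℂ ⊗[ℝ] 𝔤)
        (𝔲.toSubmodule.baseChange ℂ) ↔
      CocalibratedG2.AdmitsCocalibratedG2StarNondeg 𝔤 𝔲.toSubmodule) ∧
    (CocalibratedG2.AdmitsCocalibratedG2ComplexNondeg (ℂ ⊗[ℝ] 𝔤)
        (𝔲.toSubmodule.baseChange ℂ) ↔
      CocalibratedG2.AdmitsCocalibratedG2 𝔤) := by
  have : FiniteDimensional ℝ 𝔤 := Module.finite_of_finrank_pos (by omega)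
  obtain ⟨ξ, A, hξ, hker, h⟩ :=
    CocalibratedG2.exists_isAlmostAbelianBracket_of_abelian_ideal 𝔲 (by omega)
  have hdimC : Module.finrank ℂ (ℂ ⊗[ℝ] 𝔤) = 7 := by rw [Module.finrank_baseChange, hdim]
  have hξC := CocalibratedG2.baseChange_ne_zero hξ
  rw [hker, ← CocalibratedG2.ker_baseChange,
    h.admitsCocalibratedG2_iff hdim hξ, h.admitsCocalibratedG2Star_iff hdim hξ,
    h.admitsCocalibratedG2StarNondeg_ker_iff hdim hξ,
    h.baseChange.admitsCocalibratedG2Complex_iff hdimC hξC,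
    h.baseChange.admitsCocalibratedG2ComplexNondeg_ker_iff hdimC hξC,
    CocalibratedG2.hasTraceBivector_baseChange_iff, CocalibratedG2.hasTraceBivector_baseChange_iff]
  exact ⟨fun h6 => h6.mono (by decide), Iff.rfl, Iff.rfl, Iff.rfl, Iff.rfl⟩
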